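/- Let $G\subset\mathbb R^d$, and let $d_G(a,b)$ be the infimum of the Euclidean lengths of the continuous paths in $G$ from $a$ to $b$. Assume that $G$ is an embedded metric graph, i.e. that $(G,d_G)$ is path-connected and homeomorphic to the quotient of a disjoint union of finitely many segments $[0,\ell_i]$, $\ell_i\ge 0$, by an equivalence relation on the set of their endpoints. Let $$\delta(G)=\sup_{a\ne b\in G}\frac{d_G(a,b)}{\|a-b\|}$$ be the distortion of embedding, assumed finite, and let $\rho(G)\in[0,\infty]$ be the convexity radius: the supremum of all $r\ge 0$ such that any $a,b\in G$ with $d_G(a,b)\le 2r$ are joined by a unique geodesic (shortest path, up to reparametrization) of $(G,d_G)$. Let $S\subset\mathbb R^d$ and $\varepsilon>0$ satisfy $$4\,d_H(G,S)<\varepsilon<\frac{2\rho(G)}{\delta(G)},$$ where $d_H$ is the Euclidean Hausdorff distance. For $a,b\in S$ let $d^\varepsilon(a,b)$ be the infimum of $\sum_{i=0}^{k}\|y_i-y_{i+1}\|$ over all finite sequences $a=y_0,y_1,\dots,y_{k+1}=b$ in $S$ with $\|y_i-y_{i+1}\|<\varepsilon$ for all $i$, and let $\operatorname{diam}_\varepsilon$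 denote the diameter with respect to $d^\varepsilon$. Then every compact $Y\subset S$ with $$\delta(G)\left(\operatorname{diam}_\varepsilon Y+\frac{\varepsilon}{2}\right)<\rho(G)$$ has an $\alpha$-circumcenter in $(S,d^\varepsilon)$ for $\alpha=(9\delta(G)+8)\varepsilon$; that is, there is $x\in S$ with $d^\varepsilon(x,y)\le\frac12\operatorname{diam}_\varepsilon Y+\alpha$ for all $y\in Y$. -/

import Mathlib

open scoped ENNReal NNReal unitInterval

noncomputable section

/-! ### Metric graphs and geodesics -/

/-- The disjoint union of the segments `[0, ℓ i]`, `i < n`. -/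
abbrev Segments {n : ℕ} (ℓ : Fin n → ℝ≥0) : Type :=
  Σ i : Fin n, Set.Icc (0 : ℝ) (ℓ i)

/-- A point of the disjoint union of segments is an endpoint if it is an end of its segment. -/
def IsEndpoint {n : ℕ} {ℓ : Fin n → ℝ≥0} (p : Segments ℓ) : Prop :=
  (p.2 : ℝ) = 0 ∨ (p.2 : ℝ) = ℓ p.1

/-- The equivalence relation on the disjoint union of segments which identifies endpoints
according to the equivalence relation `R` on the set of endpoints, and nothing else. -/
def glue {n : ℕ} {ℓ : Fin n → ℝ≥0} (R : Setoid {p : Segments ℓ // IsEndpoint p}) :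
    Setoid (Segments ℓ) where
  r p q := p = q ∨ ∃ (hp : IsEndpoint p) (hq : IsEndpoint q), R ⟨p, hp⟩ ⟨q, hq⟩
  iseqv := by
    refine ⟨fun p => Or.inl rfl, ?_, ?_⟩
    · rintro p q (rfl | ⟨hp, hq, h⟩)
      · exact Or.inl rfl
      · exact Or.inr ⟨hq, hp, R.symm h⟩
    · rintro p q r (rfl | ⟨hp, hq, h⟩) h₂
      · exact h₂
      · rcases h₂ with rfl | ⟨_, hr, h'⟩
        · exact Or.inr ⟨hp, hq, h⟩
        · exact Or.inr ⟨hp, hr, R.trans h h'⟩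

/-- A path-connected (in particular non-empty) metric graph with finitely many vertices, each of
finite degree (equivalently: with finitely many edges): the space is homeomorphic to a
disjoint union of finitely many segments, glued along an equivalence relation on
the set of endpoints. -/
def IsMetricGraph (X : Type*) [EMetricSpace X] : Prop :=
  PathConnectedSpace X ∧
    ∃ (n : ℕ) (ℓ : Fin n → ℝ≥0) (R : Setoid {p : Segments ℓ // IsEndpoint p}),
      Nonempty (Quotient (glue R) ≃ₜ X)

/-- `γ` is a geodesic (shortest path) from `a` to `b`, parametrized on `[0, 1]` proportionally
to arc length. -/
def IsGeodesic {X : Type*} [EMetricSpace X] (a b : X) (γ : I → X) : Prop :=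
  γ 0 = a ∧ γ 1 = b ∧ ∀ s t : I, edist (γ s) (γ t) = edist s t * edist a b

/-- The convexity radius: the supremum (possibly infinite) of all `r ≥ 0` such that any two
points at distance at most `2 r` are joined by a unique geodesic. -/
def convexityRadius (X : Type*) [EMetricSpace X] : ℝ≥0∞ :=
  ⨆ (r : ℝ≥0) (_ : ∀ a b : X, edist a b ≤ 2 * r → ∃! γ : I → X, IsGeodesic a b γ), (r : ℝ≥0∞)

/-! ### The length metric of a Euclidean subset -/

/-- The Euclidean length of a continuous path contained in `G`. -/
def pathLength {d : ℕ} {G : Set (EuclideanSpace ℝ (Fin d))} {a b : G} (γ : Path a b) : ℝ≥0∞ :=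
  eVariationOn (fun t : I => (γ t : EuclideanSpace ℝ (Fin d))) Set.univ

/-- The length metric of `G`: the infimum of the lengths of the paths in `G` from `a` to `b`. -/
def lengthDist {d : ℕ} {G : Set (EuclideanSpace ℝ (Fin d))} (a b : G) : ℝ≥0∞ :=
  ⨅ γ : Path a b, pathLength γ

theorem edist_le_lengthDist {d : ℕ} {G : Set (EuclideanSpace ℝ (Fin d))} (a b : G) :
    edist a b ≤ lengthDist a b := by
  refine le_iInf fun γ => ?_
  have h := eVariationOn.edist_le (fun t : I => (γ t : EuclideanSpace ℝ (Fin d)))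
    (Set.mem_univ 0) (Set.mem_univ 1)
  simp only [Path.source, Path.target] at h
  exact h

theorem lengthDist_self {d : ℕ} {G : Set (EuclideanSpace ℝ (Fin d))} (a : G) :
    lengthDist a a = 0 := by
  refine le_antisymm (iInf_le_of_le (Path.refl a) ?_) zero_le
  refine (eVariationOn.constant_on ?_).le
  rintro _ ⟨s, -, rfl⟩ _ ⟨t, -, rfl⟩
  rfl

theorem lengthDist_comm_le {d : ℕ} {G : Set (EuclideanSpace ℝ (Fin d))} (a b : G) :
    lengthDist a b ≤ lengthDist b a := by
  refine le_iInf fun γ => iInf_le_of_le γ.symm ?_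
  refine eVariationOn.comp_le_of_antitoneOn (fun t : I => (γ t : EuclideanSpace ℝ (Fin d)))
    unitInterval.symm ?_ (Set.mapsTo_univ _ _)
  intro s _ t _ h
  exact unitInterval.symm_le_symm.2 h

theorem lengthDist_triangle {d : ℕ} {G : Set (EuclideanSpace ℝ (Fin d))} (a b c : G) :
    lengthDist a c ≤ lengthDist a b + lengthDist b c := by
  refine ENNReal.le_iInf_add_iInf fun γ γ' => iInf_le_of_le (γ.trans γ') ?_
  let m : I := ⟨1 / 2, by norm_num, by norm_num⟩
  have hU : (Set.univ : Set I) = Set.Iic m ∪ Set.Ici m := Set.Iic_union_Ici.symm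
  unfold pathLength
  rw [hU, eVariationOn.union _ (x := m) isGreatest_Iic isLeast_Ici]
  rw [← hU]
  refine add_le_add ?_ ?_
  · have h := eVariationOn.comp_le_of_monotoneOn
      (fun t : I => (γ t : EuclideanSpace ℝ (Fin d))) (t := Set.Iic m) (s := Set.univ)
      (fun t : I => Set.projIcc (0 : ℝ) 1 zero_le_one (2 * t))
      (fun s _ t _ h => Set.monotone_projIcc _ (by have : (s : ℝ) ≤ t := h; linarith))
      (Set.mapsTo_univ _ _)
    refine le_trans (le_of_eq (eVariationOn.congr ?_)) h
    intro t ht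
    have ht' : (t : ℝ) ≤ 1 / 2 := ht
    simp only [one_div] at ht'
    simp [Path.trans, ht', Path.extend, Set.IccExtend]
  · have h := eVariationOn.comp_le_of_monotoneOn
      (fun t : I => (γ' t : EuclideanSpace ℝ (Fin d))) (t := Set.Ici m) (s := Set.univ)
      (fun t : I => Set.projIcc (0 : ℝ) 1 zero_le_one (2 * t - 1))
      (fun s _ t _ h => Set.monotone_projIcc _ (by have : (s : ℝ) ≤ t := h; linarith))
      (Set.mapsTo_univ _ _)
    refine le_trans (le_of_eq (eVariationOn.congr ?_)) h
    intro t ht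
    have ht' : (1 / 2 : ℝ) ≤ t := ht
    rcases eq_or_lt_of_le ht' with h2 | h2
    · have h3 : (2 * (t : ℝ)) = 1 := by linarith
      simp [Path.trans, ← h2, Path.extend, Set.IccExtend]
    · have h3 : ¬ (t : ℝ) ≤ 1 / 2 := not_le.2 h2
      simp only [one_div] at h3
      simp [Path.trans, h3, Path.extend, Set.IccExtend]

/-- The set `G`, regarded as a metric space with its length metric. -/
def LengthSpace {d : ℕ} (G : Set (EuclideanSpace ℝ (Fin d))) : Type := ↥G

instance {d : ℕ} (G : Set (EuclideanSpace ℝ (Fin d))) : EMetricSpace (LengthSpace G) where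
  edist a b := lengthDist (G := G) a b
  edist_self a := lengthDist_self (G := G) a
  edist_comm a b := le_antisymm (lengthDist_comm_le (G := G) a b) (lengthDist_comm_le (G := G) b a)
  edist_triangle a b c := lengthDist_triangle (G := G) a b c
  eq_of_edist_eq_zero {a b} h := by
    have h1 : @edist ↥G _ a b ≤ 0 := (edist_le_lengthDist (G := G) a b).trans (le_of_eq h)
    exact (edist_le_zero (γ := ↥G)).1 h1

/-- A Euclidean subset is an embedded metric graph if its length metric turns it into a metric
graph. -/
def IsEmbeddedMetricGraph {d : ℕ} (G : Set (EuclideanSpace ℝ (Fin d))) : Prop :=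
  IsMetricGraph (LengthSpace G)

/-- The distortion of embedding: the supremum of `d_G(a, b) / ‖a - b‖` over `a ≠ b` in `G`. -/
def distortion {d : ℕ} (G : Set (EuclideanSpace ℝ (Fin d))) : ℝ≥0∞ :=
  ⨆ (a : G) (b : G) (_ : a ≠ b),
    lengthDist a b / edist (a : EuclideanSpace ℝ (Fin d)) (b : EuclideanSpace ℝ (Fin d))

/-! ### The path metric of a Euclidean sample -/

/-- The points `y 0, …, y n` form an `ε`-path in `S` from `a` to `b`.  (The trivial path `n = 0`
from `a` to `a` has length `0`, like the path `a, a`, and so does not affect `epsDist` below.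
The values `y i` for `i > n` play no role.) -/
def IsEpsPath {d : ℕ} {S : Set (EuclideanSpace ℝ (Fin d))} (ε : ℝ) (a b : S) (n : ℕ)
    (y : ℕ → S) : Prop :=
  y 0 = a ∧ y n = b ∧ ∀ i < n, dist (y i) (y (i + 1)) < ε

/-- The length of the path `y 0, …, y n`. -/
def epsLength {d : ℕ} {S : Set (EuclideanSpace ℝ (Fin d))} (n : ℕ) (y : ℕ → S) : ℝ≥0∞ :=
  ∑ i ∈ Finset.range n, edist (y i) (y (i + 1))

/-- The `ε`-metric on `S`: the infimum of the lengths of the `ε`-paths from `a` to `b`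
(`∞` if there is none). -/
def epsDist {d : ℕ} {S : Set (EuclideanSpace ℝ (Fin d))} (ε : ℝ) (a b : S) : ℝ≥0∞ :=
  ⨅ (n : ℕ) (y : ℕ → S) (_ : IsEpsPath ε a b n y), epsLength n y

theorem edist_le_epsDist {d : ℕ} {S : Set (EuclideanSpace ℝ (Fin d))} (ε : ℝ) (a b : S) :
    edist a b ≤ epsDist ε a b := by
  refine le_iInf fun n => le_iInf fun y => le_iInf fun h => ?_
  rw [← h.1, ← h.2.1]
  exact edist_le_range_sum_edist y n

theorem epsDist_self {d : ℕ} {S : Set (EuclideanSpace ℝ (Fin d))} (ε : ℝ) (a : S) :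
    epsDist ε a a = 0 := by
  refine le_antisymm (iInf_le_of_le 0 (iInf_le_of_le (fun _ => a) (iInf_le_of_le ?_ ?_))) zero_le
  · exact ⟨rfl, rfl, by simp⟩
  · simp [epsLength]

theorem epsDist_comm_le {d : ℕ} {S : Set (EuclideanSpace ℝ (Fin d))} (ε : ℝ) (a b : S) :
    epsDist ε a b ≤ epsDist ε b a := by
  refine le_iInf fun n => le_iInf fun y => le_iInf fun h => ?_
  refine iInf_le_of_le n (iInf_le_of_le (fun i => y (n - i)) (iInf_le_of_le ?_ ?_))
  · refine ⟨by simpa using h.2.1, by simpa using h.1, fun i hi => ?_⟩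
    have h1 := h.2.2 (n - (i + 1)) (by omega)
    have h2 : n - (i + 1) + 1 = n - i := by omega
    rw [h2, dist_comm] at h1
    exact h1
  · unfold epsLength
    rw [← Finset.sum_range_reflect (fun i => edist (y i) (y (i + 1))) n]
    refine Finset.sum_le_sum fun i hi => ?_
    have hi' := Finset.mem_range.1 hi
    have h2 : n - 1 - i + 1 = n - i := by omega
    have h3 : n - 1 - i = n - (i + 1) := by omega
    rw [h2, h3, edist_comm]

theorem epsDist_triangle {d : ℕ} {S : Set (EuclideanSpace ℝ (Fin d))} (ε : ℝ) (a b c : S) :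
    epsDist ε a c ≤ epsDist ε a b + epsDist ε b c := by
  have key : ∀ (n : ℕ) (y : ℕ → S), IsEpsPath ε a b n y →
      ∀ (m : ℕ) (z : ℕ → S), IsEpsPath ε b c m z →
      epsDist ε a c ≤ epsLength n y + epsLength m z := by
    intro n y hy m z hz
    have e1 : ∀ i ≤ n, (if i ≤ n then y i else z (i - n)) = y i := fun i hi => if_pos hi
    have e2 : ∀ i, (if n + i ≤ n then y (n + i) else z (n + i - n)) = z i := by
      intro i
      rcases Nat.eq_zero_or_pos i with rfl | hi
      · simp [hy.2.1, hz.1]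
      · rw [if_neg (by omega), Nat.add_sub_cancel_left]
    refine iInf_le_of_le (n + m) (iInf_le_of_le (fun i => if i ≤ n then y i else z (i - n))
      (iInf_le_of_le ?_ ?_))
    · refine ⟨(e1 0 (Nat.zero_le n)).trans hy.1, (e2 m).trans hz.2.1, fun i hi => ?_⟩
      rcases Nat.lt_or_ge i n with h | h
      · have h1 := e1 i h.le
        have h2 := e1 (i + 1) h
        simp only [h1, h2]
        exact hy.2.2 i h
      · obtain ⟨j, rfl⟩ := Nat.exists_eq_add_of_le h
        have h1 := e2 j
        have h2 := e2 (j + 1)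
        rw [← add_assoc] at h2
        simp only [h1, h2]
        exact hz.2.2 j (by omega)
    · unfold epsLength
      rw [Finset.sum_range_add]
      refine add_le_add (Finset.sum_le_sum fun i hi => ?_) (Finset.sum_le_sum fun i _ => ?_)
      · have h := Finset.mem_range.1 hi
        have h1 := e1 i h.le
        have h2 := e1 (i + 1) h
        simp only [h1, h2]
        exact le_rfl
      · have h1 := e2 i
        have h2 := e2 (i + 1)
        rw [← add_assoc] at h2
        simp only [h1, h2]
        exact le_rfl
  have h1 : epsDist ε a b + epsDist ε b c =
      ⨅ (n : ℕ) (y : ℕ → S) (_ : IsEpsPath ε a b n y), (epsLength n y + epsDist ε b c) := by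
    conv_lhs => rw [epsDist]
    simp only [ENNReal.iInf_add]
  rw [h1]
  refine le_iInf fun n => le_iInf fun y => le_iInf fun hy => ?_
  have h2 : epsLength n y + epsDist ε b c =
      ⨅ (m : ℕ) (z : ℕ → S) (_ : IsEpsPath ε b c m z), (epsLength n y + epsLength m z) := by
    conv_lhs => rw [epsDist]
    simp only [ENNReal.add_iInf]
  rw [h2]
  exact le_iInf fun m => le_iInf fun z => le_iInf fun hz => key n y hy m z hz

/-- The set `S`, regarded as an (extended) metric space with the metric `d^ε`. -/
def EpsSpace {d : ℕ} (S : Set (EuclideanSpace ℝ (Fin d))) (_ε : ℝ) : Type := ↥S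

instance {d : ℕ} (S : Set (EuclideanSpace ℝ (Fin d))) (ε : ℝ) : EMetricSpace (EpsSpace S ε) where
  edist a b := epsDist (S := S) ε a b
  edist_self a := epsDist_self (S := S) ε a
  edist_comm a b := le_antisymm (epsDist_comm_le (S := S) ε a b) (epsDist_comm_le (S := S) ε b a)
  edist_triangle a b c := epsDist_triangle (S := S) ε a b c
  eq_of_edist_eq_zero {a b} h := by
    have h1 : @edist ↥S _ a b ≤ 0 := (edist_le_epsDist (S := S) ε a b).trans (le_of_eq h)
    exact (edist_le_zero (γ := ↥S)).1 h1

/-- A subset `Y` of Euclidean space (in the application: of `S`), regarded as a subset of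
`(S, d^ε)`. -/
def inEpsSpace {d : ℕ} (S : Set (EuclideanSpace ℝ (Fin d))) (ε : ℝ)
    (Y : Set (EuclideanSpace ℝ (Fin d))) : Set (EpsSpace S ε) :=
  {y : ↥S | (y : EuclideanSpace ℝ (Fin d)) ∈ Y}

/-- `x` is an `α`-circumcenter of `Y`: the closed ball around `x` of radius `diam Y / 2 + α`
contains `Y`. -/
def IsAlphaCircumcenter {X : Type*} [EMetricSpace X] (α : ℝ≥0∞) (Y : Set X) (x : X) : Prop :=
  Y ⊆ Metric.closedEBall x (Metric.ediam Y / 2 + α)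

end

/-! ### Functions with slopes `±1` -/

/-! At small scales `G` is a tree. Suppose points at distance at most `2 * r` have unique geodesics,
and let `c` be the geodesic from `v` to `w`, with `u` within `r` of both. Then `t ↦ dist u (c t)`
has slope `±1` off a finite set: around an interior point of an edge `c` fills a neighbourhood, so a
geodesic from `u` must arrive along `c` (`UniqueArcs.hasDerivAt_dist`). It has no peak, since both
sides of a peak would lie on the one geodesic from `u` to the top. Hence it is a constant plus `|t -
t₀|`, and `c t₀` is the centre of a tripod (`UniqueArcs.exists_tripod`). As in a tree, a chain of
small steps must then pass near every point of the geodesic between its ends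
(`UniqueArcs.exists_dist_le_of_chain`).

Move sample points to nearby graph points by a map `g`. Let `a, b` in `Y` almost realize the
diameter, and let `x` be near the middle of an almost shortest `ε`-path between them. For `y` in
`Y`, let `m` be the centre of the tripod on `g a, g b, g y`. If `x` lies on the side of `a`, the
paths from `a` to `b` and from `a` to `y` both pass near `m`, where one can switch between them at
bounded cost. As `a` and `b` are almost as far apart as possible, the leg of `y` beyond `m` is
hardly longer than that of `b`, so `y` is hardly farther from `x` than the half path to `b`
(`exists_circumcenter_of_chains`). -/

theorem continuousOn_of_abs_sub_le {f : ℝ → ℝ} {s : Set ℝ}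
    (h : ∀ x ∈ s, ∀ y ∈ s, |f x - f y| ≤ |x - y|) : ContinuousOn f s := by
  have : LipschitzOnWith 1 f s := by
    refine LipschitzOnWith.of_dist_le_mul fun x hx y hy => ?_
    simpa [Real.dist_eq] using h x hx y hy
  exact this.continuousOn

/-- A function with derivatives `±1` on an open interval is affine of slope `1` or `-1`. -/
theorem unit_slope_of_hasDerivAt {f : ℝ → ℝ} {a b : ℝ} (hf : ContinuousOn f (Set.Icc a b))
    (hder : ∀ t ∈ Set.Ioo a b, HasDerivAt f 1 t ∨ HasDerivAt f (-1) t) :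
    (∀ t ∈ Set.Icc a b, f t = f a + (t - a)) ∨ (∀ t ∈ Set.Icc a b, f t = f a - (t - a)) := by
  have hd : ∀ t ∈ Set.Ioo a b, HasDerivAt f (deriv f t) t ∧ (deriv f t = 1 ∨ deriv f t = -1) := by
    intro t ht
    rcases hder t ht with h | h
    · exact ⟨h.differentiableAt.hasDerivAt, Or.inl h.deriv⟩
    · exact ⟨h.differentiableAt.hasDerivAt, Or.inr h.deriv⟩
  have hmvt : ∀ t ∈ Set.Icc a b, t = a ∨ ∃ x ∈ Set.Ioo a b, f t = f a + deriv f x * (t - a) := by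
    intro t ht
    rcases eq_or_lt_of_le ht.1 with h | h
    · exact Or.inl h.symm
    · right
      obtain ⟨x, hx, hx'⟩ := exists_hasDerivAt_eq_slope f (deriv f) h
        (hf.mono (Set.Icc_subset_Icc le_rfl ht.2))
        (fun x hx => (hd x ⟨hx.1, hx.2.trans_le ht.2⟩).1)
      refine ⟨x, ⟨hx.1, hx.2.trans_le ht.2⟩, ?_⟩
      rw [hx', div_mul_cancel₀ _ (sub_pos.2 h).ne']
      ring
  -- Darboux: a derivative that avoids `0` keeps its sign, so only one of the two values occurs.
  rcases hasDerivWithinAt_forall_lt_or_forall_gt_of_forall_ne (convex_Ioo a b)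
    (fun x hx => (hd x hx).1.hasDerivWithinAt) (m := 0)
    (fun x hx => by rcases (hd x hx).2 with h | h <;> rw [h] <;> norm_num) with h | h
  · right
    intro t ht
    rcases hmvt t ht with rfl | ⟨x, hx, hx'⟩
    · simp
    · have h1 := h x hx
      rcases (hd x hx).2 with h2 | h2
      · rw [h2] at h1; norm_num at h1
      · rw [hx', h2]; ring
  · left
    intro t ht
    rcases hmvt t ht with rfl | ⟨x, hx, hx'⟩
    · simp
    · have h1 := h x hx
      rcases (hd x hx).2 with h2 | h2
      · rw [hx', h2]; ring
      · rw [h2] at h1; norm_num at h1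

/-- Continuous induction along the interval. The identity can only break where the slope turns from
`1` to `-1`, which is a peak, or at `a`, where a downward slope contradicts minimality. -/
theorem eq_add_of_no_peak {f : ℝ → ℝ} {a b : ℝ}
    (hlip : ∀ s ∈ Set.Icc a b, ∀ t ∈ Set.Icc a b, |f s - f t| ≤ |s - t|)
    {F : Set ℝ} (hF : F.Finite)
    (hder : ∀ t ∈ Set.Ioo a b, t ∉ F → HasDerivAt f 1 t ∨ HasDerivAt f (-1) t)
    (hpeak : ∀ t x, 0 < x → a ≤ t - x → t + x ≤ b → f (t - x) = f t - x → f (t + x) ≠ f t - x)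
    (hmin : ∀ t ∈ Set.Icc a b, f a ≤ f t) :
    ∀ t ∈ Set.Icc a b, f t = f a + (t - a) := by
  have hc := continuousOn_of_abs_sub_le hlip
  have key : Set.Icc a b ⊆ {t | f t = f a + (t - a)} := by
    refine IsClosed.Icc_subset_of_forall_exists_gt ?_ (by simp) ?_
    · have : {t | f t = f a + (t - a)} ∩ Set.Icc a b
          = Set.Icc a b ∩ (fun t => f t - (f a + (t - a))) ⁻¹' {0} := by
        ext t
        simp [sub_eq_zero, and_comm]
      rw [this]
      exact (hc.sub (by fun_prop)).preimage_isClosed_of_isClosed isClosed_Icc isClosed_singleton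
    · rintro x ⟨hx, hxa, hxb⟩ y hy
      have hx : f x = f a + (x - a) := hx
      have hy : x < y := hy
      -- `x` itself may be exceptional; only a short open interval to its right has to avoid `F`.
      have hev : ∀ᶠ z in nhds x, z ∉ F \ {x} :=
        (hF.subset Set.sdiff_subset).isClosed.isOpen_compl.eventually_mem (by simp)
      obtain ⟨e, he, hez⟩ := Metric.eventually_nhds_iff.1 hev
      obtain ⟨z, hz1, hz2⟩ : ∃ z, x < z ∧ z ≤ x + e / 2 ∧ z ≤ y ∧ z ≤ b :=
        ⟨min (x + e / 2) (min y b), by simp; exact ⟨he, hy, hxb⟩, by simp⟩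
      obtain ⟨hz2, hz3, hz4⟩ := hz2
      have hsl := unit_slope_of_hasDerivAt (f := f) (a := x) (b := z)
        (hc.mono (Set.Icc_subset_Icc hxa hz4)) (by
          intro t ht
          refine hder t ⟨hxa.trans_lt ht.1, ht.2.trans_le hz4⟩ fun htF => ?_
          refine hez (y := t) ?_ ⟨htF, ht.1.ne'⟩
          rw [Real.dist_eq, abs_of_pos (sub_pos.2 ht.1)]
          linarith [ht.2])
      rcases hsl with h | h
      · refine ⟨z, ?_, hz1, hz3⟩
        have := h z ⟨hz1.le, le_rfl⟩
        simp only [Set.mem_ofPred_eq]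
        linarith
      · exfalso
        rcases eq_or_lt_of_le hxa with rfl | hax
        · have h1 := h z ⟨hz1.le, le_rfl⟩
          have h2 := hmin z ⟨hz1.le, hz4⟩
          linarith
        · obtain ⟨w, hw0, hw1, hw2⟩ : ∃ w, 0 < w ∧ w ≤ z - x ∧ w ≤ x - a :=
            ⟨min (z - x) (x - a), by simp; exact ⟨hz1, hax⟩, by simp⟩
          refine hpeak x w hw0 (by linarith) (by linarith) ?_ ?_
          -- The Lipschitz bounds from `x` and from `a` together pin `f (x - w)` to `f x - w`.
          · have h1 := hlip (x - w) ⟨by linarith, by linarith⟩ x ⟨hxa, hxb.le⟩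
            have h2 := hlip (x - w) ⟨by linarith, by linarith⟩ a ⟨le_rfl, by linarith⟩
            rw [show x - w - x = -w by ring, abs_neg, abs_of_pos hw0] at h1
            rw [abs_of_nonneg (show 0 ≤ x - w - a by linarith)] at h2
            have h1' := (abs_le.1 h1).1
            have h2' := (abs_le.1 h2).2
            linarith
          · have := h (x + w) ⟨by linarith, by linarith⟩
            linarith
  exact fun t ht => key ht

/-- A nonexpanding function on an interval whose slopes are `±1` off a finite set, and which has
no peak, is the distance to a point up to a constant. -/
theorem exists_eq_add_abs_of_no_peak {f : ℝ → ℝ} {L : ℝ} (hL : 0 ≤ L)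
    (hlip : ∀ s ∈ Set.Icc 0 L, ∀ t ∈ Set.Icc 0 L, |f s - f t| ≤ |s - t|)
    {F : Set ℝ} (hF : F.Finite)
    (hder : ∀ t ∈ Set.Ioo 0 L, t ∉ F → HasDerivAt f 1 t ∨ HasDerivAt f (-1) t)
    (hpeak : ∀ t x, 0 < x → 0 ≤ t - x → t + x ≤ L → f (t - x) = f t - x → f (t + x) ≠ f t - x) :
    ∃ t₀ ∈ Set.Icc 0 L, ∀ t ∈ Set.Icc 0 L, f t = f t₀ + |t - t₀| := by
  obtain ⟨t₀, ht₀, hmin⟩ := isCompact_Icc.exists_isMinOn (Set.nonempty_Icc.2 hL)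
    (continuousOn_of_abs_sub_le hlip)
  have hmin : ∀ t ∈ Set.Icc 0 L, f t₀ ≤ f t := fun t ht => hmin ht
  refine ⟨t₀, ht₀, fun t ht => ?_⟩
  rcases le_total t₀ t with h | h
  · rw [abs_of_nonneg (sub_nonneg.2 h)]
    refine eq_add_of_no_peak (f := f) (a := t₀) (b := L) ?_ hF ?_ ?_ ?_ t ⟨h, ht.2⟩
    · exact fun s hs u hu => hlip s ⟨ht₀.1.trans hs.1, hs.2⟩ u ⟨ht₀.1.trans hu.1, hu.2⟩
    · exact fun s hs => hder s ⟨ht₀.1.trans_lt hs.1, hs.2⟩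
    · exact fun s x hx h1 h2 => hpeak s x hx (ht₀.1.trans h1) h2
    · exact fun s hs => hmin s ⟨ht₀.1.trans hs.1, hs.2⟩
  · rw [abs_of_nonpos (sub_nonpos.2 h)]
    have := eq_add_of_no_peak (f := fun s => f (-s)) (a := -t₀) (b := 0) (F := Neg.neg '' F)
      ?_ (hF.image _) ?_ ?_ ?_ (-t) ⟨by linarith, by linarith [ht.1]⟩
    · simp only [neg_neg] at this
      rw [this]; ring
    · intro s hs u hu
      have := hlip (-s) ⟨by linarith [hs.2], by linarith [hs.1, ht₀.2]⟩
        (-u) ⟨by linarith [hu.2], by linarith [hu.1, ht₀.2]⟩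
      rwa [show -s - -u = -(s - u) by ring, abs_neg] at this
    · intro s hs hsF
      have hs' : -s ∉ F := fun h => hsF ⟨-s, h, by simp⟩
      rcases hder (-s) ⟨by linarith [hs.2], by linarith [hs.1, ht₀.2]⟩ hs' with h | h
      · right
        have := HasDerivAt.scomp s h (hasDerivAt_neg s)
        simp only [smul_eq_mul, mul_one] at this
        exact this
      · left
        have := HasDerivAt.scomp s h (hasDerivAt_neg s)
        simp only [smul_eq_mul, mul_one, mul_neg, neg_neg] at this
        exact this
    · intro s x hx h1 h2 h3 h4
      refine hpeak (-s) x hx (by linarith) (by linarith [ht₀.2]) ?_ ?_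
      · simpa [sub_eq_add_neg, add_comm] using h4
      · simpa [sub_eq_add_neg, add_comm] using h3
    · intro s hs
      simp only [neg_neg]
      exact hmin _ ⟨by linarith [hs.2], by linarith [hs.1, ht₀.2]⟩

/-! ### Arcs in metric graphs -/

/-- Invariance of domain in dimension one: injectivity forces strict monotonicity, and the
intermediate value theorem fills in the image. -/
theorem image_Icc_mem_nhds {h : ℝ → ℝ} {a b t : ℝ} (hc : ContinuousOn h (Set.Icc a b))
    (hi : Set.InjOn h (Set.Icc a b)) (ht : t ∈ Set.Ioo a b) : h '' Set.Icc a b ∈ nhds (h t) := by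
  have hab : a ≤ b := (ht.1.trans ht.2).le
  have ha : a ∈ Set.Icc a b := ⟨le_rfl, hab⟩
  have hb : b ∈ Set.Icc a b := ⟨hab, le_rfl⟩
  have htt : t ∈ Set.Icc a b := ⟨ht.1.le, ht.2.le⟩
  rcases hc.strictMonoOn_of_injOn_Icc' hab hi with hm | hm
  · exact Filter.mem_of_superset (Icc_mem_nhds (hm ha htt ht.1) (hm htt hb ht.2))
      (intermediate_value_Icc hab hc)
  · exact Filter.mem_of_superset (Icc_mem_nhds (hm htt hb ht.2) (hm ha htt ht.1))
      (intermediate_value_Icc' hab hc)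

/-- An injective path into a space which meets an open subset homeomorphic to an interval
is open there. -/
theorem image_mem_nhds_of_isOpenEmbedding {X : Type*} [TopologicalSpace X] {l : ℝ}
    {j : Set.Ioo (0 : ℝ) l → X} (hj : Topology.IsOpenEmbedding j) {c : ℝ → X} {L t : ℝ}
    (hc : ContinuousOn c (Set.Icc 0 L)) (hi : Set.InjOn c (Set.Icc 0 L)) (ht : t ∈ Set.Ioo 0 L)
    (hr : c t ∈ Set.range j) : c '' Set.Icc 0 L ∈ nhds (c t) := by
  obtain ⟨z₀, hz₀⟩ := hr
  have : Nonempty (Set.Ioo (0 : ℝ) l) := ⟨z₀⟩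
  have hct : ContinuousAt c t := hc.continuousAt (Icc_mem_nhds ht.1 ht.2)
  have hev : ∀ᶠ s in nhds t, c s ∈ Set.range j ∧ s ∈ Set.Ioo 0 L :=
    (hct.eventually (hj.isOpen_range.eventually_mem ⟨z₀, hz₀⟩)).and (isOpen_Ioo.eventually_mem ht)
  obtain ⟨e, he, hez⟩ := Metric.eventually_nhds_iff.1 hev
  set a := t - e / 2
  set b := t + e / 2
  have hsub : ∀ s ∈ Set.Icc a b, c s ∈ Set.range j ∧ s ∈ Set.Ioo 0 L := by
    intro s hs
    refine hez ?_
    rw [Real.dist_eq, abs_lt]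
    constructor <;> simp only [a, b, Set.mem_Icc] at hs <;> linarith [hs.1, hs.2]
  have hsub' : Set.Icc a b ⊆ Set.Icc 0 L := fun s hs => ⟨(hsub s hs).2.1.le, (hsub s hs).2.2.le⟩
  -- Read in the chart `j`, the path near `t` is an injective real function.
  let P := hj.toOpenPartialHomeomorph
  have hPl : ∀ z, P.symm (j z) = z := fun z => by
    have := P.left_inv (x := z) (by simp [P])
    simpa [P] using this
  have hPr : ∀ s ∈ Set.Icc a b, j (P.symm (c s)) = c s := by
    intro s hs
    obtain ⟨z, hz⟩ := (hsub s hs).1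
    rw [← hz, hPl]
  have hcont : ContinuousOn (fun s => (P.symm (c s) : ℝ)) (Set.Icc a b) := by
    refine continuous_subtype_val.comp_continuousOn ?_
    refine P.continuousOn_symm.comp (hc.mono hsub') fun s hs => ?_
    simpa [P] using (hsub s hs).1
  have hinj : Set.InjOn (fun s => (P.symm (c s) : ℝ)) (Set.Icc a b) := by
    intro s hs u hu h
    refine hi (hsub' hs) (hsub' hu) ?_
    rw [← hPr s hs, ← hPr u hu, Subtype.ext h]
  have hab : t ∈ Set.Ioo a b := ⟨by simp [a, he], by simp [b, he]⟩
  have hn := image_Icc_mem_nhds hcont hinj hab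
  have hn2 : {z : Set.Ioo (0 : ℝ) l | (z : ℝ) ∈ (fun s => (P.symm (c s) : ℝ)) '' Set.Icc a b}
      ∈ nhds (P.symm (c t)) := continuous_subtype_val.continuousAt hn
  have hn3 := hj.isOpenMap.image_mem_nhds hn2
  rw [hPr t ⟨hab.1.le, hab.2.le⟩] at hn3
  refine Filter.mem_of_superset hn3 ?_
  rintro _ ⟨z, ⟨s, hs, hz⟩, rfl⟩
  refine ⟨s, hsub' hs, ?_⟩
  rw [← hPr s hs, Subtype.ext hz]

theorem finite_setOf_isEndpoint {n : ℕ} (ℓ : Fin n → ℝ≥0) :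
    {p : Segments ℓ | IsEndpoint p}.Finite := by
  have : {p : Segments ℓ | IsEndpoint p} ⊆
      Set.range (fun i => (⟨i, ⟨0, le_rfl, (ℓ i).2⟩⟩ : Segments ℓ)) ∪
      Set.range (fun i => (⟨i, ⟨ℓ i, (ℓ i).2, le_rfl⟩⟩ : Segments ℓ)) := by
    rintro ⟨i, x, hx⟩ (h | h)
    · left
      simp only at h
      subst h
      exact ⟨i, rfl⟩
    · right
      simp only at h
      subst h
      exact ⟨i, rfl⟩
  exact ((Set.finite_range _).union (Set.finite_range _)).subset this

/-- The inclusion of the interior of a segment into a metric graph. -/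
def edgeMap {n : ℕ} {ℓ : Fin n → ℝ≥0} (R : Setoid {p : Segments ℓ // IsEndpoint p}) (i : Fin n)
    (x : Set.Ioo (0 : ℝ) (ℓ i)) : Quotient (glue R) :=
  Quotient.mk (glue R) ⟨i, ⟨x, x.2.1.le, x.2.2.le⟩⟩

/-- Interior points of a segment are glued to nothing, so the preimage in the disjoint union of an
open set of them is that set, which is open there. -/
theorem isOpenEmbedding_edgeMap {n : ℕ} {ℓ : Fin n → ℝ≥0}
    (R : Setoid {p : Segments ℓ // IsEndpoint p}) (i : Fin n) :
    Topology.IsOpenEmbedding (edgeMap R i) := by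
  have hne : ∀ x : Set.Ioo (0 : ℝ) (ℓ i),
      ¬ IsEndpoint (⟨i, ⟨x, x.2.1.le, x.2.2.le⟩⟩ : Segments ℓ) := by
    rintro x (h | h)
    · exact x.2.1.ne' h
    · exact x.2.2.ne h
  have hmk : ∀ (x : Set.Ioo (0 : ℝ) (ℓ i)) (p : Segments ℓ),
      edgeMap R i x = Quotient.mk (glue R) p → (⟨i, ⟨x, x.2.1.le, x.2.2.le⟩⟩ : Segments ℓ) = p := by
    intro x p h
    rcases Quotient.exact h with h | ⟨h, -⟩
    · exact h
    · exact absurd h (hne x)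
  have hemb : Topology.IsOpenEmbedding
      (fun x : Set.Ioo (0 : ℝ) (ℓ i) => (⟨x, x.2.1.le, x.2.2.le⟩ : Set.Icc (0 : ℝ) (ℓ i))) := by
    refine ⟨⟨?_, ?_⟩, ?_⟩
    · refine Topology.IsInducing.of_comp (g := Subtype.val) (by fun_prop) (by fun_prop) ?_
      exact Topology.IsInducing.subtypeVal
    · intro x y h
      simpa [Subtype.ext_iff] using h
    · have : Set.range (fun x : Set.Ioo (0 : ℝ) (ℓ i) =>
          (⟨x, x.2.1.le, x.2.2.le⟩ : Set.Icc (0 : ℝ) (ℓ i))) = Subtype.val ⁻¹' Set.Ioo 0 (ℓ i : ℝ) := by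
        ext z
        constructor
        · rintro ⟨x, rfl⟩
          exact x.2
        · intro h
          exact ⟨⟨z, h⟩, rfl⟩
      rw [this]
      exact isOpen_Ioo.preimage continuous_subtype_val
  refine .of_continuous_injective_isOpenMap ?_ ?_ ?_
  · exact continuous_quotient_mk'.comp (continuous_sigmaMk.comp hemb.continuous)
  · intro x y h
    have := hmk x _ h
    have h2 := eq_of_heq (Sigma.mk.inj_iff.1 this).2
    exact Subtype.ext (congrArg (fun z : Set.Icc (0 : ℝ) (ℓ i) => (z : ℝ)) h2)
  · intro U hU
    have hmap : IsOpenMap (fun x : Set.Icc (0 : ℝ) (ℓ i) => (⟨i, x⟩ : Segments ℓ)) :=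
      @isOpenMap_sigmaMk (Fin n) (fun i => Set.Icc (0 : ℝ) (ℓ i)) _ i
    have hopen := hmap.comp hemb.isOpenMap U hU
    refine isQuotientMap_quotient_mk'.isOpen_preimage.1 ?_
    convert hopen using 1
    ext p
    constructor
    · rintro ⟨x, hx, h⟩
      exact ⟨x, hx, hmk x p h⟩
    · rintro ⟨x, hx, rfl⟩
      exact ⟨x, hx, rfl⟩

/-- In a metric graph, an injective path is open at all but finitely many times. -/
theorem exists_finite_image_mem_nhds {X : Type*} [TopologicalSpace X] {n : ℕ} {ℓ : Fin n → ℝ≥0}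
    {R : Setoid {p : Segments ℓ // IsEndpoint p}} (e : Quotient (glue R) ≃ₜ X) {c : ℝ → X} {L : ℝ}
    (hc : ContinuousOn c (Set.Icc 0 L)) (hi : Set.InjOn c (Set.Icc 0 L)) :
    ∃ F : Set ℝ, F.Finite ∧ ∀ t ∈ Set.Ioo 0 L, t ∉ F → c '' Set.Icc 0 L ∈ nhds (c t) := by
  -- `V` is the finite set of vertices; an injective path meets each of them at most once.
  set V : Set X := (fun p => e (Quotient.mk (glue R) p)) '' {p : Segments ℓ | IsEndpoint p}
  refine ⟨Set.Icc 0 L ∩ c ⁻¹' V, ?_, ?_⟩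
  · refine Set.Finite.of_finite_image (f := c) ?_ (hi.mono Set.inter_subset_left)
    refine ((finite_setOf_isEndpoint ℓ).image _).subset (s := V) ?_
    rintro _ ⟨t, ht, rfl⟩
    exact ht.2
  · intro t ht htF
    obtain ⟨⟨i, x⟩, hp⟩ := Quotient.exists_rep (e.symm (c t))
    have hp' : e (Quotient.mk (glue R) ⟨i, x⟩) = c t := by
      rw [hp, e.apply_symm_apply]
    have hne : ¬ IsEndpoint (⟨i, x⟩ : Segments ℓ) := fun h =>
      htF ⟨⟨ht.1.le, ht.2.le⟩, ⟨_, h, hp'⟩⟩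
    have hx : (x : ℝ) ∈ Set.Ioo (0 : ℝ) (ℓ i) :=
      ⟨lt_of_le_of_ne x.2.1 fun h => hne (Or.inl h.symm),
        lt_of_le_of_ne x.2.2 fun h => hne (Or.inr h)⟩
    exact image_mem_nhds_of_isOpenEmbedding
      (e.isOpenEmbedding.comp (isOpenEmbedding_edgeMap R i)) hc hi ht ⟨⟨x, hx⟩, hp'⟩

/-! ### Uniquely geodesic spaces with thin triangles -/

section Arcs

variable {X : Type*} [MetricSpace X]

/-- `c` restricted to `[0, L]` is a geodesic from `a` to `b`, parametrized by arc length. -/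
def IsArc (c : ℝ → X) (L : ℝ) (a b : X) : Prop :=
  c 0 = a ∧ c L = b ∧ ∀ s ∈ Set.Icc 0 L, ∀ t ∈ Set.Icc 0 L, dist (c s) (c t) = |s - t|

/-- The point `m` lies on a geodesic from `a` to `b`, metrically. -/
def IsBetween (a m b : X) : Prop := dist a m + dist m b = dist a b

theorem IsBetween.symm {a m b : X} (h : IsBetween a m b) : IsBetween b m a := by
  unfold IsBetween at *
  rw [dist_comm b m, dist_comm m a, dist_comm b a]
  linarith

theorem IsBetween.trans {a m q b : X} (h : IsBetween a m q) (h' : IsBetween a q b) :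
    IsBetween a m b := by
  unfold IsBetween at *
  have h1 := dist_triangle m q b
  have h2 := dist_triangle a m b
  linarith

theorem IsArc.eq_dist {c : ℝ → X} {L : ℝ} {a b : X} (h : IsArc c L a b) (hL : 0 ≤ L) :
    dist a b = L := by
  rw [← h.1, ← h.2.1, h.2.2 0 ⟨le_rfl, hL⟩ L ⟨hL, le_rfl⟩, zero_sub, abs_neg, abs_of_nonneg hL]

theorem IsArc.dist_left {c : ℝ → X} {L : ℝ} {a b : X} (h : IsArc c L a b) {t : ℝ}
    (ht : t ∈ Set.Icc 0 L) : dist a (c t) = t := by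
  rw [← h.1, h.2.2 0 ⟨le_rfl, ht.1.trans ht.2⟩ t ht, zero_sub, abs_neg, abs_of_nonneg ht.1]

theorem IsArc.dist_right {c : ℝ → X} {L : ℝ} {a b : X} (h : IsArc c L a b) {t : ℝ}
    (ht : t ∈ Set.Icc 0 L) : dist (c t) b = L - t := by
  rw [← h.2.1, h.2.2 t ht L ⟨ht.1.trans ht.2, le_rfl⟩, abs_sub_comm,
    abs_of_nonneg (sub_nonneg.2 ht.2)]

theorem IsArc.isBetween {c : ℝ → X} {L : ℝ} {a b : X} (h : IsArc c L a b) {t : ℝ}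
    (ht : t ∈ Set.Icc 0 L) : IsBetween a (c t) b := by
  unfold IsBetween
  rw [h.dist_left ht, h.dist_right ht, h.eq_dist (ht.1.trans ht.2)]
  ring

theorem IsArc.continuousOn {c : ℝ → X} {L : ℝ} {a b : X} (h : IsArc c L a b) :
    ContinuousOn c (Set.Icc 0 L) := by
  have : LipschitzOnWith 1 c (Set.Icc 0 L) := by
    refine LipschitzOnWith.of_dist_le_mul fun x hx y hy => ?_
    simpa [Real.dist_eq] using (h.2.2 x hx y hy).le
  exact this.continuousOn

theorem IsArc.injOn {c : ℝ → X} {L : ℝ} {a b : X} (h : IsArc c L a b) :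
    Set.InjOn c (Set.Icc 0 L) := by
  intro s hs t ht hst
  have := h.2.2 s hs t ht
  rw [hst, dist_self] at this
  exact sub_eq_zero.1 (abs_eq_zero.1 this.symm)

theorem IsArc.trans {c c' : ℝ → X} {a m b : X} (h : IsArc c (dist a m) a m)
    (h' : IsArc c' (dist m b) m b) (hm : IsBetween a m b) :
    IsArc (fun t => if t ≤ dist a m then c t else c' (t - dist a m)) (dist a b) a b := by
  unfold IsBetween at hm
  have key : ∀ s t, 0 ≤ s → s ≤ t → t ≤ dist a b →
      dist (if s ≤ dist a m then c s else c' (s - dist a m))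
        (if t ≤ dist a m then c t else c' (t - dist a m)) = t - s := by
    intro s t hs hst ht
    by_cases h1 : t ≤ dist a m
    · rw [if_pos h1, if_pos (hst.trans h1), h.2.2 s ⟨hs, hst.trans h1⟩ t ⟨hs.trans hst, h1⟩,
        abs_sub_comm, abs_of_nonneg (sub_nonneg.2 hst)]
    · push Not at h1
      have ht' : t - dist a m ∈ Set.Icc 0 (dist m b) := ⟨by linarith, by linarith⟩
      rw [if_neg h1.not_ge]
      by_cases h2 : s ≤ dist a m
      · rw [if_pos h2]
        have hs' : s ∈ Set.Icc 0 (dist a m) := ⟨hs, h2⟩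
        have e1 := h.dist_left hs'
        have e2 := h.dist_right hs'
        have e3 := h'.dist_left ht'
        have e4 := h'.dist_right ht'
        refine le_antisymm ?_ ?_
        · linarith [dist_triangle (c s) m (c' (t - dist a m))]
        -- A shortcut past the junction `m` would give a route from `a` to `b` shorter than `dist a
        -- b`.
        · linarith [dist_triangle4 a (c s) (c' (t - dist a m)) b]
      · push Not at h2
        rw [if_neg h2.not_ge, h'.2.2 _ ⟨by linarith, by linarith⟩ _ ht', abs_sub_comm,
          abs_of_nonneg (by linarith)]
        ring
  refine ⟨?_, ?_, ?_⟩
  · simp [h.1]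
  · by_cases h1 : dist a b ≤ dist a m
    · have h2 : dist m b = 0 := le_antisymm (by linarith) dist_nonneg
      have h3 : m = b := dist_eq_zero.1 h2
      subst h3
      simp [h.2.1]
    · simp only [if_neg h1]
      rw [← hm, add_sub_cancel_left, h'.2.1]
  · intro s hs t ht
    rcases le_total s t with hst | hst
    · rw [key s t hs.1 hst ht.2, abs_sub_comm, abs_of_nonneg (sub_nonneg.2 hst)]
    · rw [dist_comm, key t s ht.1 hst hs.2, abs_of_nonneg (sub_nonneg.2 hst)]

/-- Points at distance at most `R` are joined by a unique geodesic. -/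
structure UniqueArcs (X : Type*) [MetricSpace X] (R : ℝ) : Prop where
  exists_arc : ∀ a b : X, dist a b ≤ R → ∃ c, IsArc c (dist a b) a b
  unique : ∀ (a b : X) (c c' : ℝ → X), dist a b ≤ R → IsArc c (dist a b) a b →
    IsArc c' (dist a b) a b → Set.EqOn c c' (Set.Icc 0 (dist a b))

/-- Geodesics are open subsets away from finitely many of their points. -/
def ArcsAlmostOpen (X : Type*) [MetricSpace X] : Prop :=
  ∀ (c : ℝ → X) (L : ℝ) (a b : X), IsArc c L a b →
    ∃ F : Set ℝ, F.Finite ∧ ∀ t ∈ Set.Ioo 0 L, t ∉ F → c '' Set.Icc 0 L ∈ nhds (c t)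

variable {R : ℝ}

/-- A point between `a` and `b` lies on the geodesic. -/
theorem UniqueArcs.eq_of_isBetween (H : UniqueArcs X R) {a b m : X} {c : ℝ → X}
    (hab : dist a b ≤ R) (hc : IsArc c (dist a b) a b) (hm : IsBetween a m b) :
    c (dist a m) = m := by
  have hm' : dist a m + dist m b = dist a b := hm
  -- Geodesics from `a` to `m` and from `m` to `b` concatenate to a geodesic, which uniqueness
  -- identifies with `c`.
  obtain ⟨c₁, h₁⟩ := H.exists_arc a m (by linarith [dist_nonneg (x := m) (y := b)])
  obtain ⟨c₂, h₂⟩ := H.exists_arc m b (by linarith [dist_nonneg (x := a) (y := m)])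
  have hmem : dist a m ∈ Set.Icc 0 (dist a b) :=
    ⟨dist_nonneg, by linarith [dist_nonneg (x := m) (y := b)]⟩
  have := H.unique a b _ _ hab hc (h₁.trans h₂ hm) hmem
  rw [this]
  simp [h₁.2.1]

theorem UniqueArcs.isBetween_or_isBetween (H : UniqueArcs X R) {a b m q : X}
    (hab : dist a b ≤ R) (hm : IsBetween a m b) (hq : IsBetween a q b) :
    IsBetween a m q ∨ IsBetween q m b := by
  obtain ⟨c, hc⟩ := H.exists_arc a b hab
  have em := H.eq_of_isBetween hab hc hm
  have eq := H.eq_of_isBetween hab hc hq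
  have hm' : dist a m + dist m b = dist a b := hm
  have hq' : dist a q + dist q b = dist a b := hq
  have h1 := dist_nonneg (x := m) (y := b)
  have h2 := dist_nonneg (x := q) (y := b)
  have e := hc.2.2 (dist a m) ⟨dist_nonneg, by linarith⟩ (dist a q) ⟨dist_nonneg, by linarith⟩
  rw [em, eq] at e
  unfold IsBetween
  rcases le_total (dist a m) (dist a q) with h | h
  · left
    rw [e, abs_of_nonpos (by linarith)]
    ring
  · right
    rw [dist_comm q m, e, abs_of_nonneg (by linarith)]
    linarith

/-- Near a time where it is open, the distance to a geodesic has slope `1` or `-1`. -/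
theorem UniqueArcs.hasDerivAt_dist (H : UniqueArcs X R) {u v w : X} {c : ℝ → X} {L : ℝ}
    (hc : IsArc c L v w) (hu : ∀ t ∈ Set.Icc 0 L, dist u (c t) ≤ R)
    (hpeak : ∀ t x, 0 < x → 0 ≤ t - x → t + x ≤ L → dist u (c (t - x)) = dist u (c t) - x →
      dist u (c (t + x)) ≠ dist u (c t) - x)
    {t : ℝ} (ht : t ∈ Set.Ioo 0 L) (hut : u ≠ c t) (hopen : c '' Set.Icc 0 L ∈ nhds (c t)) :
    HasDerivAt (fun s => dist u (c s)) 1 t ∨ HasDerivAt (fun s => dist u (c s)) (-1) t := by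
  obtain ⟨e₀, he₀, hball⟩ := Metric.mem_nhds_iff.1 hopen
  have hpos : 0 < dist u (c t) := dist_pos.2 hut
  obtain ⟨e, he, he1, he2, he3, he4⟩ : ∃ e, 0 < e ∧ e < e₀ ∧ e < dist u (c t) ∧ e ≤ t ∧ e ≤ L - t := by
    refine ⟨min (min (e₀ / 2) (dist u (c t) / 2)) (min t (L - t)), ?_, ?_, ?_, ?_, ?_⟩
    · have h1 := ht.1
      have h2 := sub_pos.2 ht.2
      positivity
    · exact ((min_le_left _ _).trans (min_le_left _ _)).trans_lt (by linarith)
    · exact ((min_le_left _ _).trans (min_le_right _ _)).trans_lt (by linarith)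
    · exact (min_le_right _ _).trans (min_le_left _ _)
    · exact (min_le_right _ _).trans (min_le_right _ _)
  set A := dist u (c (t - e)) + e
  set B := dist u (c (t + e)) + e
  have hmem : ∀ x, |x| ≤ e → t + x ∈ Set.Icc 0 L := fun x hx => by
    have := abs_le.1 hx
    exact ⟨by linarith, by linarith⟩
  have hcd : ∀ x y, |x| ≤ e → |y| ≤ e → dist (c (t + x)) (c (t + y)) = |x - y| := fun x y hx hy => by
    rw [hc.2.2 _ (hmem x hx) _ (hmem y hy)]
    congr 1
    ring
  have hee : |e| ≤ e := (abs_of_pos he).le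
  have hee' : |-e| ≤ e := by rw [abs_neg]; exact hee
  -- `A + x` and `B - x` are the lengths of the routes through `c (t - e)` and `c (t + e)`. No other
  -- route is shorter: a geodesic from `u` starts outside the ball of radius `e` about `c t`, so it
  -- meets the sphere, and there the only points are `c (t ± e)` because `c` covers the larger ball.
  have hfx : ∀ x, |x| ≤ e → dist u (c (t + x)) = min (A + x) (B - x) := by
    intro x hx
    have hx' := abs_le.1 hx
    have d1 := hcd (-e) x hee' hx
    have d2 := hcd e x hee hx
    rw [abs_of_nonpos (by linarith), ← sub_eq_add_neg] at d1
    rw [abs_of_nonneg (by linarith)] at d2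
    refine le_antisymm (le_min ?_ ?_) ?_
    · linarith [dist_triangle u (c (t - e)) (c (t + x))]
    · linarith [dist_triangle u (c (t + e)) (c (t + x))]
    · obtain ⟨g, hg⟩ := H.exists_arc u (c (t + x)) (hu _ (hmem x hx))
      have hcx : dist (c (t + x)) (c t) = |x| := by
        simpa using hcd x 0 hx (by simpa using he.le)
      obtain ⟨s, hs, hse⟩ := intermediate_value_Icc' (f := fun s => dist (g s) (c t))
        dist_nonneg (continuous_dist.comp_continuousOn (hg.continuousOn.prodMk continuousOn_const))
        (show e ∈ _ from ⟨by rw [hg.2.1, hcx]; exact hx, by rw [hg.1]; exact he2.le⟩)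
      have hse : dist (g s) (c t) = e := hse
      obtain ⟨τ, hτ, hτg⟩ := hball (show g s ∈ Metric.ball (c t) e₀ by
        rw [Metric.mem_ball, hse]; exact he1)
      have h1 := hc.2.2 τ hτ t ⟨ht.1.le, ht.2.le⟩
      rw [hτg, hse] at h1
      have hb := hg.isBetween hs
      unfold IsBetween at hb
      rcases eq_or_eq_neg_of_abs_eq h1.symm with h | h
      · have : g s = c (t + e) := by rw [← hτg]; congr 1; linarith
        rw [this] at hb
        refine (min_le_right _ _).trans ?_
        linarith
      · have : g s = c (t - e) := by rw [← hτg]; congr 1; linarith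
        rw [this] at hb
        refine (min_le_left _ _).trans ?_
        linarith
  -- If the two branches of the minimum crossed inside the window, their crossing `x = (B - A) / 2`
  -- would be a peak.
  have hAB : 2 * e ≤ B - A ∨ 2 * e ≤ A - B := by
    by_contra! hcon
    obtain ⟨x, hx⟩ : ∃ x, x = (B - A) / 2 := ⟨_, rfl⟩
    have hx1 : |x| < e := by rw [abs_lt]; constructor <;> linarith
    have hx2 := abs_lt.1 hx1
    obtain ⟨y, hy0, hy1, hy2⟩ : ∃ y, 0 < y ∧ y ≤ e - x ∧ y ≤ e + x :=
      ⟨min (e - x) (e + x), lt_min (by linarith) (by linarith), min_le_left _ _, min_le_right _ _⟩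
    have e0 := hfx x hx1.le
    have e1 := hfx (x - y) (abs_le.2 ⟨by linarith, by linarith⟩)
    have e2 := hfx (x + y) (abs_le.2 ⟨by linarith, by linarith⟩)
    rw [min_eq_left (by linarith)] at e0 e1
    rw [min_eq_right (by linarith)] at e2
    refine hpeak (t + x) y hy0 (by linarith) (by linarith) ?_ ?_
    · rw [e0, show t + x - y = t + (x - y) by ring, e1]; ring
    · rw [e0, show t + x + y = t + (x + y) by ring, e2]; linarith
  have hnear : ∀ᶠ s in nhds t, |s - t| ≤ e := by
    filter_upwards [Metric.ball_mem_nhds t he] with s hs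
    exact (Metric.mem_ball.1 hs).le
  rcases hAB with h | h
  · left
    refine HasDerivAt.congr_of_eventuallyEq (f := fun s => s + (A - t)) ?_ ?_
    · exact (hasDerivAt_id t).add_const _
    · filter_upwards [hnear] with s hs
      have hs' := abs_le.1 hs
      have := hfx (s - t) hs
      rw [min_eq_left (by linarith), add_sub_cancel] at this
      rw [this]; ring
  · right
    refine HasDerivAt.congr_of_eventuallyEq (f := fun s => -s + (B + t)) ?_ ?_
    · exact (hasDerivAt_neg t).add_const _
    · filter_upwards [hnear] with s hs
      have hs' := abs_le.1 hs
      have := hfx (s - t) hs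
      rw [min_eq_right (by linarith), add_sub_cancel] at this
      rw [this]; ring

/-- Geodesic triangles with two sides of length at most `r` are tripods. -/
theorem UniqueArcs.exists_tripod {r : ℝ} (H : UniqueArcs X (2 * r)) (hX : ArcsAlmostOpen X)
    {u v w : X} (hv : dist u v ≤ r) (hw : dist u w ≤ r) :
    ∃ q, IsBetween u q v ∧ IsBetween u q w ∧ IsBetween v q w := by
  have hvw : dist v w ≤ 2 * r := by linarith [dist_triangle_left v w u]
  obtain ⟨c, hc⟩ := H.exists_arc v w hvw
  set L := dist v w
  have hL : 0 ≤ L := dist_nonneg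
  -- The routes to `c t` through `v` and through `w` have mean length at most `r + L / 2`.
  have hu : ∀ t ∈ Set.Icc 0 L, dist u (c t) ≤ 2 * r := by
    intro t ht
    have h1 := hc.dist_left ht
    have h2 := hc.dist_right ht
    have h3 := dist_triangle u v (c t)
    have h4 := dist_triangle u w (c t)
    rw [dist_comm w] at h4
    linarith
  have hpeak : ∀ t x, 0 < x → 0 ≤ t - x → t + x ≤ L → dist u (c (t - x)) = dist u (c t) - x →
      dist u (c (t + x)) ≠ dist u (c t) - x := by
    intro t x hx h1 h2 h3 h4
    have ht : t ∈ Set.Icc 0 L := ⟨by linarith, by linarith⟩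
    have hm : t - x ∈ Set.Icc 0 L := ⟨by linarith, by linarith⟩
    have hp : t + x ∈ Set.Icc 0 L := ⟨by linarith, by linarith⟩
    obtain ⟨g, hg⟩ := H.exists_arc u (c t) (hu t ht)
    have e1 := H.eq_of_isBetween (hu t ht) hg (m := c (t - x)) (by
      unfold IsBetween
      rw [h3, hc.2.2 _ hm _ ht, show t - x - t = -x by ring, abs_neg, abs_of_pos hx]; ring)
    have e2 := H.eq_of_isBetween (hu t ht) hg (m := c (t + x)) (by
      unfold IsBetween
      rw [h4, hc.2.2 _ hp _ ht, add_sub_cancel_left, abs_of_pos hx]; ring)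
    rw [h3] at e1
    rw [h4, e1] at e2
    have := hc.injOn hm hp e2
    linarith
  obtain ⟨F, hF, hFo⟩ := hX c L v w hc
  obtain ⟨t₀, ht₀, hq⟩ := exists_eq_add_abs_of_no_peak (f := fun s => dist u (c s)) hL
    -- The distance to `u` has a corner where `c` meets `u`, which happens at most once.
    (F := F ∪ (Set.Icc 0 L ∩ c ⁻¹' {u})) (by
      intro s hs t ht
      rw [← hc.2.2 s hs t ht, dist_comm u, dist_comm u]
      exact abs_dist_sub_le _ _ _)
    (hF.union (Set.Finite.of_finite_image
      ((Set.finite_singleton u).subset (by rintro _ ⟨t, ht, rfl⟩; exact ht.2))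
      (hc.injOn.mono Set.inter_subset_left)))
    (by
      intro t ht htF
      refine H.hasDerivAt_dist hc hu hpeak ht ?_ (hFo t ht fun h => htF (Or.inl h))
      exact fun h => htF (Or.inr ⟨⟨ht.1.le, ht.2.le⟩, h.symm⟩))
    hpeak
  have h0 := hq 0 ⟨le_rfl, hL⟩
  have h1 := hq L ⟨hL, le_rfl⟩
  simp only [hc.1, hc.2.1] at h0 h1
  rw [zero_sub, abs_neg, abs_of_nonneg ht₀.1] at h0
  rw [abs_of_nonneg (sub_nonneg.2 ht₀.2)] at h1
  refine ⟨c t₀, ?_, ?_, hc.isBetween ht₀⟩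
  · unfold IsBetween
    rw [h0, dist_comm (c t₀), hc.dist_left ht₀]
  · unfold IsBetween
    rw [h1, hc.dist_right ht₀]

/-- On the tripod, `m` lies on the leg of `u` or on the leg of `w`. -/
theorem UniqueArcs.isBetween_of_isBetween {r : ℝ} (H : UniqueArcs X (2 * r))
    (hX : ArcsAlmostOpen X) {u v w m : X} (hv : dist u v ≤ r) (hw : dist u w ≤ r)
    (hm : IsBetween u m w) : IsBetween u m v ∨ IsBetween v m w := by
  obtain ⟨q, hqv, hqw, hvw⟩ := H.exists_tripod hX hv hw
  have hr : dist u w ≤ 2 * r := by linarith [dist_nonneg (x := u) (y := w)]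
  rcases H.isBetween_or_isBetween hr hm hqw with h | h
  · exact Or.inl (h.trans hqv)
  · exact Or.inr (h.symm.trans hvw.symm).symm

/-- A chain in a ball around its first point passes near all points of the geodesic between its
ends. -/
theorem UniqueArcs.exists_dist_le_of_chain {r : ℝ} (H : UniqueArcs X (2 * r))
    (hX : ArcsAlmostOpen X) {κ : ℝ} (hκ : 0 ≤ κ) (z : ℕ → X) {m : X} :
    ∀ n : ℕ, (∀ i ≤ n, dist (z 0) (z i) ≤ r) → (∀ i < n, dist (z i) (z (i + 1)) ≤ 2 * κ) →
      IsBetween (z 0) m (z n) → ∃ i ≤ n, dist (z i) m ≤ κ := by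
  intro n
  induction n with
  | zero =>
    intro _ _ hm
    refine ⟨0, le_rfl, ?_⟩
    unfold IsBetween at hm
    rw [dist_self] at hm
    linarith [dist_nonneg (x := z 0) (y := m), dist_nonneg (x := m) (y := z 0)]
  | succ n ih =>
    intro h1 h2 hm
    -- Either `m` already lies on the geodesic to `z n`, or it lies on that of the last step, one of
    -- whose ends is then within half of `2 * κ`.
    rcases H.isBetween_of_isBetween hX (h1 n (by omega)) (h1 (n + 1) le_rfl) hm with h | h
    · obtain ⟨i, hi, hi'⟩ := ih (fun i hi => h1 i (by omega)) (fun i hi => h2 i (by omega)) h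
      exact ⟨i, by omega, hi'⟩
    · have h3 := h2 n (by omega)
      unfold IsBetween at h
      rcases le_total (dist (z n) m) κ with h4 | h4
      · exact ⟨n, by omega, h4⟩
      · refine ⟨n + 1, le_rfl, ?_⟩
        rw [dist_comm]
        linarith

/-! ### From geodesics on the unit interval to arcs -/

theorem IsGeodesic.isArc {a b : X} {γ : I → X} (h : IsGeodesic a b γ) :
    IsArc (fun t => γ (Set.projIcc 0 1 zero_le_one (t / dist a b))) (dist a b) a b := by
  have hd : ∀ s t : I, dist (γ s) (γ t) = dist s t * dist a b := fun s t => by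
    have := congrArg ENNReal.toReal (h.2.2 s t)
    rwa [ENNReal.toReal_mul, ← dist_edist, ← dist_edist, ← dist_edist] at this
  -- For `a = b` the quotient `t / 0` is `0`, so the arc is constant.
  rcases eq_or_ne a b with rfl | hab
  · refine ⟨?_, ?_, ?_⟩
    · simpa using h.1
    · simpa using h.1
    · intro s hs t ht
      rw [dist_self] at hs ht
      rw [hd, dist_self, mul_zero, le_antisymm hs.2 hs.1, le_antisymm ht.2 ht.1]
      simp
  · have hpos : 0 < dist a b := dist_pos.2 hab
    refine ⟨?_, ?_, ?_⟩
    · simpa using h.1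
    · simpa [div_self hpos.ne'] using h.2.1
    · intro s hs t ht
      have hmem : ∀ x ∈ Set.Icc 0 (dist a b), x / dist a b ∈ Set.Icc (0 : ℝ) 1 := fun x hx =>
        ⟨div_nonneg hx.1 hpos.le, (div_le_one hpos).2 hx.2⟩
      rw [hd, Set.projIcc_of_mem _ (hmem s hs), Set.projIcc_of_mem _ (hmem t ht), Subtype.dist_eq,
        Real.dist_eq, ← sub_div, abs_div, abs_of_pos hpos, div_mul_cancel₀ _ hpos.ne']

theorem IsArc.isGeodesic {a b : X} {c : ℝ → X} (h : IsArc c (dist a b) a b) :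
    IsGeodesic a b (fun s : I => c (dist a b * s)) := by
  refine ⟨by simpa using h.1, by simpa using h.2.1, fun s t => ?_⟩
  have hmem : ∀ x : I, dist a b * x ∈ Set.Icc 0 (dist a b) := fun x =>
    ⟨mul_nonneg dist_nonneg x.2.1, mul_le_of_le_one_right dist_nonneg x.2.2⟩
  rw [edist_dist, edist_dist, edist_dist, ← ENNReal.ofReal_mul dist_nonneg,
    h.2.2 _ (hmem s) _ (hmem t), ← mul_sub, abs_mul, abs_of_nonneg dist_nonneg, Subtype.dist_eq,
    Real.dist_eq, mul_comm]

theorem uniqueArcs_of_existsUnique_isGeodesic {R : ℝ≥0}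
    (h : ∀ a b : X, edist a b ≤ R → ∃! γ : I → X, IsGeodesic a b γ) : UniqueArcs X R := by
  have hle : ∀ a b : X, dist a b ≤ R → edist a b ≤ R := fun a b hab => by
    rw [edist_dist]
    exact ENNReal.ofReal_le_of_le_toReal hab
  refine ⟨fun a b hab => ?_, fun a b c c' hab hc hc' t ht => ?_⟩
  · obtain ⟨γ, hγ, -⟩ := h a b (hle a b hab)
    exact ⟨_, hγ.isArc⟩
  · have := (h a b (hle a b hab)).unique hc.isGeodesic hc'.isGeodesic
    rcases (dist_nonneg (x := a) (y := b)).eq_or_lt with h0 | hpos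
    · rw [← h0] at ht
      rw [le_antisymm ht.2 ht.1, hc.1, hc'.1]
    · have e := congrFun this ⟨t / dist a b, div_nonneg ht.1 hpos.le, (div_le_one hpos).2 ht.2⟩
      simpa [mul_div_cancel₀ _ hpos.ne', hpos.ne', mul_div_cancel_left₀] using e

end Arcs

theorem arcsAlmostOpen_of_homeomorph {X : Type*} [MetricSpace X] {n : ℕ} {ℓ : Fin n → ℝ≥0}
    {R : Setoid {p : Segments ℓ // IsEndpoint p}} (e : Quotient (glue R) ≃ₜ X) :
    ArcsAlmostOpen X :=
  fun _ _ _ _ hc => exists_finite_image_mem_nhds e hc.continuousOn hc.injOn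

/-! ### Circumcenters along coarse chains -/

/-- A discrete intermediate value theorem, used to find the near-midpoint of a chain. -/
theorem exists_le_le_add_of_step {Λ : ℕ → ℝ} {ε T : ℝ} (hε : 0 ≤ ε) (h0 : Λ 0 ≤ T) :
    ∀ n : ℕ, (∀ i < n, Λ (i + 1) ≤ Λ i + ε) → T ≤ Λ n → ∃ k ≤ n, Λ k ≤ T ∧ T ≤ Λ k + ε := by
  intro n
  induction n with
  | zero => exact fun _ h => ⟨0, le_rfl, h0, by linarith⟩
  | succ n ih =>
    intro hs h
    rcases le_or_gt T (Λ n) with h1 | h1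
    · obtain ⟨k, hk, hk'⟩ := ih (fun i hi => hs i (by omega)) h1
      exact ⟨k, by omega, hk'⟩
    · exact ⟨n, by omega, h1.le, h.trans (hs n (by omega))⟩

/-- The points `z 0, …, z n` form a chain from `p` to `q` in `V` with cumulative lengths `Λ`,
total length at most `ℓ` and steps at most `ε`, whose image under `g` has steps at most `2 κ` and
diameter at most `r`. -/
structure IsChainAlong {V X : Type*} [PseudoEMetricSpace V] [MetricSpace X] (g : V → X)
    (r κ ε ℓ : ℝ) (p q : V) (n : ℕ) (z : ℕ → V) (Λ : ℕ → ℝ) : Prop where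
  start : z 0 = p
  finish : z n = q
  zero : Λ 0 = 0
  mono : Monotone Λ
  edist_le : ∀ i j, i ≤ j → j ≤ n → edist (z i) (z j) ≤ ENNReal.ofReal (Λ j - Λ i)
  step : ∀ i < n, Λ (i + 1) ≤ Λ i + ε
  length_le : Λ n ≤ ℓ
  dist_le : ∀ i ≤ n, ∀ j ≤ n, dist (g (z i)) (g (z j)) ≤ r
  step_image : ∀ i < n, dist (g (z i)) (g (z (i + 1))) ≤ 2 * κ

theorem edist_le_ofReal_add {V : Type*} [PseudoEMetricSpace V] {x y z : V} {s t : ℝ} (hs : 0 ≤ s)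
    (ht : 0 ≤ t) (h : edist x y ≤ ENNReal.ofReal s) (h' : edist y z ≤ ENNReal.ofReal t) :
    edist x z ≤ ENNReal.ofReal (s + t) := by
  rw [ENNReal.ofReal_add hs ht]
  exact (edist_triangle x y z).trans (add_le_add h h')

/-- `V` stands for the sample with `d^ε`, and `E` is the price of switching between chains near a
common point. The bound consists of half a chain, `(D + η) / 2`, then `ε` for missing the midpoint,
`E` for one switch, and `E + 2 * η` for the excess of the leg of `y`. -/
theorem exists_circumcenter_of_chains {V X : Type*} [PseudoEMetricSpace V] [MetricSpace X]
    {r κ ε η D E : ℝ} (H : UniqueArcs X (2 * r)) (hX : ArcsAlmostOpen X) (g : V → X)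
    (hκ : 0 ≤ κ) (hε : 0 ≤ ε) (hη : 0 ≤ η) (hE0 : 0 ≤ E)
    (hE : ∀ p q, dist (g p) (g q) ≤ 2 * r → dist (g p) (g q) ≤ 2 * κ →
      edist p q ≤ ENNReal.ofReal E)
    {Y : Set V} {a b : V} (ha : a ∈ Y) (hb : b ∈ Y)
    (hab : ENNReal.ofReal D ≤ edist a b + ENNReal.ofReal η)
    (hY : ∀ p ∈ Y, ∀ q ∈ Y, ∃ n z Λ, IsChainAlong g r κ ε (D + η) p q n z Λ) :
    ∃ x, ∀ y ∈ Y, edist x y ≤ ENNReal.ofReal (D / 2 + ε + 2 * E + 5 / 2 * η) := by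
  obtain ⟨n, z, Λ, hz⟩ := hY a ha b hb
  have hΛ : ∀ i, 0 ≤ Λ i := fun i => hz.zero.symm.le.trans (hz.mono (Nat.zero_le i))
  have hlow : ∀ u, 0 ≤ u → edist a b ≤ ENNReal.ofReal u → D ≤ u + η := by
    intro u hu h
    have := hab.trans (add_le_add_left h _)
    rw [← ENNReal.ofReal_add hu hη] at this
    exact (ENNReal.ofReal_le_ofReal_iff (by linarith)).1 this
  obtain ⟨k, hkn, hk1, hk2⟩ := exists_le_le_add_of_step (T := Λ n / 2) hε
    (by rw [hz.zero]; linarith [hΛ n]) n hz.step (by linarith [hΛ n])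
  refine ⟨z k, fun y hy => ?_⟩
  have hdist : ∀ p ∈ Y, ∀ q ∈ Y, dist (g p) (g q) ≤ r := by
    intro p hp q hq
    obtain ⟨n, z, Λ, h⟩ := hY p hp q hq
    have := h.dist_le 0 (Nat.zero_le _) n le_rfl
    rwa [h.start, h.finish] at this
  obtain ⟨m, hmb, hmy, hbmy⟩ := H.exists_tripod hX (hdist a ha b hb) (hdist a ha y hy)
  have hnear : ∀ {p q : V} {n : ℕ} {z : ℕ → V} {Λ : ℕ → ℝ},
      IsChainAlong g r κ ε (D + η) p q n z Λ → IsBetween (g p) m (g q) →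
      ∃ i ≤ n, dist (g (z i)) m ≤ κ := by
    intro p q n z Λ h hm
    refine H.exists_dist_le_of_chain hX hκ (fun i => g (z i)) n
      (fun i hi => h.dist_le 0 (Nat.zero_le _) i hi) h.step_image ?_
    simpa only [h.start, h.finish] using hm
  obtain ⟨i, hin, him⟩ := hnear hz hmb
  -- `y` is joined to whichever of `a`, `b` lies on the same side of `z i` as the midpoint `z k`.
  rcases le_total k i with hki | hki
  · obtain ⟨n', z', Λ', hz'⟩ := hY a ha y hy
    obtain ⟨j, hjn, hjm⟩ := hnear hz' hmy
    have hΛ' : 0 ≤ Λ' j := hz'.zero.symm.le.trans (hz'.mono (Nat.zero_le j))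
    have hpq : edist (z i) (z' j) ≤ ENNReal.ofReal E := by
      refine hE _ _ ?_ ?_
      · have h1 := hz.dist_le 0 (Nat.zero_le _) i hin
        have h2 := hz'.dist_le 0 (Nat.zero_le _) j hjn
        rw [hz.start] at h1
        rw [hz'.start] at h2
        linarith [dist_triangle_left (g (z i)) (g (z' j)) (g a)]
      · linarith [dist_triangle_right (g (z i)) (g (z' j)) m]
    have e1 := hz.edist_le k i hki hin
    have e2 := hz.edist_le i n hin le_rfl
    have e3 := hz'.edist_le 0 j (Nat.zero_le _) hjn
    have e4 := hz'.edist_le j n' hjn le_rfl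
    have m1 := hz.mono hki
    have m2 := hz.mono hin
    have m4 := hz'.mono hjn
    rw [hz.finish] at e2
    rw [hz'.start, hz'.zero, sub_zero] at e3
    rw [hz'.finish] at e4
    -- The route from `a` along the second chain, switching near `m` to the first, also reaches `b`.
    -- So it has length at least `D - η`, which bounds the leg of `y` beyond `z' j`.
    have l := hlow _ (by linarith) (edist_le_ofReal_add (by linarith) (by linarith)
      (edist_le_ofReal_add hΛ' hE0 e3 (by rwa [edist_comm])) e2)
    refine (edist_le_ofReal_add (by linarith) (by linarith)
      (edist_le_ofReal_add (by linarith) hE0 e1 hpq) e4).trans (ENNReal.ofReal_le_ofReal ?_)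
    linarith [hz.length_le, hz'.length_le]
  · obtain ⟨n', z', Λ', hz'⟩ := hY b hb y hy
    obtain ⟨j, hjn, hjm⟩ := hnear hz' hbmy
    have hΛ' : 0 ≤ Λ' j := hz'.zero.symm.le.trans (hz'.mono (Nat.zero_le j))
    have hpq : edist (z i) (z' j) ≤ ENNReal.ofReal E := by
      refine hE _ _ ?_ ?_
      · have h1 := hz.dist_le n le_rfl i hin
        have h2 := hz'.dist_le 0 (Nat.zero_le _) j hjn
        rw [hz.finish] at h1
        rw [hz'.start] at h2
        linarith [dist_triangle_left (g (z i)) (g (z' j)) (g b)]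
      · linarith [dist_triangle_right (g (z i)) (g (z' j)) m]
    have e1 := hz.edist_le i k hki hkn
    have e2 := hz.edist_le 0 i (Nat.zero_le _) hin
    have e3 := hz'.edist_le 0 j (Nat.zero_le _) hjn
    have e4 := hz'.edist_le j n' hjn le_rfl
    have m1 := hz.mono hki
    have m4 := hz'.mono hjn
    rw [hz.start, hz.zero, sub_zero] at e2
    rw [hz'.start, hz'.zero, sub_zero] at e3
    rw [hz'.finish] at e4
    rw [edist_comm] at e1 e3
    have l := hlow _ (by linarith [hΛ i]) (edist_le_ofReal_add (by linarith [hΛ i]) hΛ'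
      (edist_le_ofReal_add (hΛ i) hE0 e2 hpq) e3)
    refine (edist_le_ofReal_add (by linarith) (by linarith)
      (edist_le_ofReal_add (by linarith) hE0 e1 hpq) e4).trans (ENNReal.ofReal_le_ofReal ?_)
    linarith [hz.length_le, hz'.length_le]

/-! ### The path metric of a sample -/

section Sample

variable {d : ℕ} {S : Set (EuclideanSpace ℝ (Fin d))} {ε : ℝ}

theorem epsDist_le_sum {y : ℕ → S} {i j : ℕ} (hij : i ≤ j)
    (h : ∀ k, i ≤ k → k < j → dist (y k) (y (k + 1)) < ε) :
    epsDist ε (y i) (y j) ≤ ENNReal.ofReal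
      (∑ k ∈ Finset.range j, dist (y k) (y (k + 1)) - ∑ k ∈ Finset.range i, dist (y k) (y (k + 1)))
    := by
  obtain ⟨n, rfl⟩ := Nat.exists_eq_add_of_le hij
  refine iInf_le_of_le n (iInf_le_of_le (fun k => y (i + k)) (iInf_le_of_le ⟨rfl, rfl, ?_⟩ ?_))
  · exact fun k hk => h (i + k) (by omega) (by omega)
  · rw [Finset.sum_range_add, add_sub_cancel_left,
      ENNReal.ofReal_sum_of_nonneg fun _ _ => dist_nonneg]
    exact (Finset.sum_congr rfl fun k _ => edist_dist _ _).le

theorem exists_isEpsPath_of_epsDist_lt {a b : S} {ℓ : ℝ}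
    (h : epsDist ε a b < ENNReal.ofReal ℓ) :
    ∃ n y, IsEpsPath ε a b n y ∧ ∑ k ∈ Finset.range n, dist (y k) (y (k + 1)) ≤ ℓ := by
  obtain ⟨n, h⟩ := iInf_lt_iff.1 h
  obtain ⟨y, h⟩ := iInf_lt_iff.1 h
  obtain ⟨hy, h⟩ := iInf_lt_iff.1 h
  refine ⟨n, y, hy, ?_⟩
  have e : epsLength n y = ENNReal.ofReal (∑ k ∈ Finset.range n, dist (y k) (y (k + 1))) := by
    rw [ENNReal.ofReal_sum_of_nonneg fun _ _ => dist_nonneg]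
    exact Finset.sum_congr rfl fun k _ => edist_dist _ _
  rw [e] at h
  exact ((ENNReal.ofReal_lt_ofReal_iff_of_nonneg (Finset.sum_nonneg fun _ _ => dist_nonneg)).1 h).le

/-- Sampling a path at steps of length at most `ε / 2` bounds the path metric. -/
theorem epsDist_le_of_lipschitz (hε : 0 < ε) {c : ℝ → EuclideanSpace ℝ (Fin d)} {L : ℝ}
    (hL : 0 ≤ L) (hc : ∀ s ∈ Set.Icc 0 L, ∀ t ∈ Set.Icc 0 L, dist (c s) (c t) ≤ |s - t|)
    (hcS : ∀ s ∈ Set.Icc 0 L, ∃ x ∈ S, dist (c s) x < ε / 4) {p q : S}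
    (hp : dist (c 0) p < ε / 4) (hq : dist (c L) q < ε / 4) :
    epsDist ε p q ≤ ENNReal.ofReal (2 * L + ε) := by
  -- Gaps of at most `ε / 2` and two displacements below `ε / 4` keep every step below `ε`. The `+
  -- 1` makes `n` positive even for `L = 0`, so that `p` and `q` get different indices.
  set n := ⌊2 * L / ε⌋₊ + 1 with hn
  have hnpos : (0 : ℝ) < n := by positivity
  have hn1 : 2 * L / ε ≤ n := by
    rw [hn]; push_cast; exact (Nat.lt_floor_add_one _).le
  have hn2 : (n : ℝ) ≤ 2 * L / ε + 1 := by
    rw [hn]; push_cast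
    linarith [Nat.floor_le (show 0 ≤ 2 * L / ε by positivity)]
  have hmem : ∀ i ≤ n, (i : ℝ) * (L / n) ∈ Set.Icc 0 L := by
    intro i hi
    refine ⟨by positivity, ?_⟩
    have hi' : (i : ℝ) ≤ n := by exact_mod_cast hi
    calc (i : ℝ) * (L / n) ≤ n * (L / n) := by gcongr
      _ = L := by field_simp
  have hex : ∀ i, ∃ x : S, i ≤ n → dist (c (i * (L / n))) x < ε / 4 := by
    intro i
    by_cases hi : i ≤ n
    · obtain ⟨x, hx, h⟩ := hcS _ (hmem i hi)
      exact ⟨⟨x, hx⟩, fun _ => h⟩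
    · exact ⟨p, fun h => absurd h hi⟩
  choose w hw using hex
  let y : ℕ → S := fun i => if i = 0 then p else if i = n then q else w i
  have hy0 : y 0 = p := by simp [y]
  have hyn : y n = q := by simp [y, hn]
  have hy : ∀ i ≤ n, dist (c (i * (L / n))) (y i) < ε / 4 := by
    intro i hi
    by_cases h0 : i = 0
    · subst h0
      rw [hy0]
      simpa using hp
    · by_cases h1 : i = n
      · subst h1
        rw [hyn, mul_div_cancel₀ _ hnpos.ne']
        exact hq
      · have : y i = w i := by simp [y, h0, h1]
        rw [this]
        exact hw i hi
  have hLn : L / n ≤ ε / 2 := by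
    rw [div_le_iff₀ hnpos]
    rw [div_le_iff₀ hε] at hn1
    linarith
  have hstep : ∀ i < n, dist (y i) (y (i + 1)) < ε := by
    intro i hi
    have h1 := hy i hi.le
    have h2 := hy (i + 1) hi
    have h3 := hc _ (hmem i hi.le) _ (hmem (i + 1) hi)
    have h4 : |(i : ℝ) * (L / n) - ((i + 1 : ℕ) : ℝ) * (L / n)| = L / n := by
      push_cast
      rw [show (i : ℝ) * (L / n) - (i + 1) * (L / n) = -(L / n) by ring, abs_neg,
        abs_of_nonneg (by positivity)]
    rw [h4] at h3
    have h5 := dist_triangle4 (y i : EuclideanSpace ℝ (Fin d)) (c (i * (L / n)))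
      (c ((i + 1 : ℕ) * (L / n))) (y (i + 1))
    rw [dist_comm (y i : EuclideanSpace ℝ (Fin d)) (c (i * (L / n)))] at h5
    rw [Subtype.dist_eq]
    linarith
  have := epsDist_le_sum (Nat.zero_le n) fun k _ hk => hstep k hk
  rw [hy0, hyn, Finset.sum_range_zero, sub_zero] at this
  refine this.trans (ENNReal.ofReal_le_ofReal ?_)
  calc ∑ k ∈ Finset.range n, dist (y k) (y (k + 1)) ≤ ∑ k ∈ Finset.range n, ε :=
        Finset.sum_le_sum fun k hk => (hstep k (Finset.mem_range.1 hk)).le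
    _ = n * ε := by simp
    _ ≤ (2 * L / ε + 1) * ε := by gcongr
    _ = 2 * L + ε := by field_simp

end Sample

/-! ### The length metric -/

theorem lengthDist_le_distortion_mul {d : ℕ} {G : Set (EuclideanSpace ℝ (Fin d))} (a b : G) :
    lengthDist a b ≤ distortion G * edist a b := by
  rcases eq_or_ne a b with rfl | hab
  · simp [lengthDist_self]
  · have h : lengthDist a b / edist a b ≤ distortion G :=
      le_iSup_of_le a (le_iSup_of_le b (le_iSup_of_le hab le_rfl))
    exact (ENNReal.div_le_iff (edist_pos.2 hab).ne' (edist_ne_top a b)).1 h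

/-- The clause on `E.edist` ties the existentially given metric to the original one. -/
theorem IsMetricGraph.exists_metricSpace {X : Type*} [E : EMetricSpace X] (hX : IsMetricGraph X)
    (hfin : ∀ x y : X, edist x y ≠ ⊤) {r : ℝ≥0}
    (hr : ∀ a b : X, edist a b ≤ 2 * r → ∃! γ : I → X, IsGeodesic a b γ) :
    ∃ M : MetricSpace X, (∀ a b : X, E.edist a b = ENNReal.ofReal (M.dist a b)) ∧
      UniqueArcs X (2 * r) ∧ ArcsAlmostOpen X := by
  obtain ⟨-, n, ℓ, R, ⟨e⟩⟩ := hX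
  let M : MetricSpace X := EMetricSpace.toMetricSpace hfin
  refine ⟨M, fun a b => edist_dist a b, ?_, arcsAlmostOpen_of_homeomorph e⟩
  have := uniqueArcs_of_existsUnique_isGeodesic (X := X) (R := 2 * r) fun a b hab =>
    hr a b (by push_cast at hab; exact hab)
  push_cast at this
  exact this

theorem exists_ediam_le_edist_add {V : Type*} [PseudoEMetricSpace V] {Y : Set V}
    (hY : Y.Nonempty) (hd : Metric.ediam Y ≠ ⊤) {η : ℝ≥0∞} (hη : η ≠ 0) :
    ∃ a ∈ Y, ∃ b ∈ Y, Metric.ediam Y ≤ edist a b + η := by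
  by_contra! h
  obtain ⟨p, hp⟩ := hY
  -- The pair `(p, p)` shows that the subtraction below is not truncated.
  have hη' : η < Metric.ediam Y := by simpa using h p hp p hp
  have h1 : Metric.ediam Y ≤ Metric.ediam Y - η :=
    Metric.ediam_le fun a ha b hb => ENNReal.le_sub_of_add_le_right hη'.ne_top (h a ha b hb).le
  exact absurd h1 (ENNReal.sub_lt_self hd (bot_le.trans_lt hη').ne' hη).not_ge

/-! ### Projection of the sample to the graph and choice of constants -/

theorem proposition4 {d : ℕ} (G S : Set (EuclideanSpace ℝ (Fin d)))
    (hG : IsEmbeddedMetricGraph G) (hδ : distortion G < ⊤)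
    (ε : ℝ) (hε : 0 < ε)
    (hS : 4 * Metric.hausdorffEDist G S < ENNReal.ofReal ε)
    (hερ : ENNReal.ofReal ε < 2 * convexityRadius (LengthSpace G) / distortion G)
    (Y : Set (EuclideanSpace ℝ (Fin d))) (hYS : Y ⊆ S) (hY : IsCompact Y)
    (hdiam : distortion G * (Metric.ediam (inEpsSpace S ε Y) + ENNReal.ofReal ε / 2)
      < convexityRadius (LengthSpace G)) :
    ∃ x : EpsSpace S ε,
      IsAlphaCircumcenter ((9 * distortion G + 8) * ENNReal.ofReal ε) (inEpsSpace S ε Y) x := by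
  obtain ⟨x₀⟩ : Nonempty (LengthSpace G) := hG.1.nonempty
  have hS' : Metric.hausdorffEDist G S < ENNReal.ofReal (ε / 4) := by
    rw [ENNReal.ofReal_div_of_pos (by norm_num), ENNReal.lt_div_iff_mul_lt (by simp) (by simp),
      mul_comm]
    simpa using hS
  have hGS : ∀ x ∈ G, ∃ s ∈ S, dist x s < ε / 4 := by
    intro x hx
    obtain ⟨s, hs, h⟩ := Metric.exists_edist_lt_of_hausdorffEDist_lt hx hS'
    exact ⟨s, hs, by rwa [edist_lt_ofReal] at h⟩
  have hSG : ∀ s : EpsSpace S ε, ∃ x : LengthSpace G, dist s.1 x.1 < ε / 4 := by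
    intro s
    obtain ⟨x, hx, h⟩ := Metric.exists_edist_lt_of_hausdorffEDist_lt s.2
      (by rwa [Metric.hausdorffEDist_comm])
    exact ⟨⟨x, hx⟩, by rwa [edist_lt_ofReal] at h⟩
  choose g hg using hSG
  obtain ⟨s₀⟩ : Nonempty (EpsSpace S ε) := by
    obtain ⟨s, hs, -⟩ := hGS x₀.1 x₀.2
    exact ⟨(⟨s, hs⟩ : S)⟩
  by_cases hD : Metric.ediam (inEpsSpace S ε Y) = ⊤
  · refine ⟨s₀, fun y _ => ?_⟩
    rw [Metric.mem_closedEBall, hD, ENNReal.top_div_of_ne_top (by simp), top_add]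
    exact le_top
  rcases (inEpsSpace S ε Y).eq_empty_or_nonempty with hempty | hne
  · exact ⟨s₀, by simp [IsAlphaCircumcenter, hempty]⟩
  -- The supremum `ρ` need not be attained, so an admissible `r` is taken that still exceeds the
  -- left side.
  obtain ⟨r, hr⟩ := lt_iSup_iff.1 hdiam
  obtain ⟨hru, hr⟩ := lt_iSup_iff.1 hr
  obtain ⟨δ, hδ0, hδe⟩ : ∃ δ : ℝ, 0 ≤ δ ∧ distortion G = ENNReal.ofReal δ :=
    ⟨_, ENNReal.toReal_nonneg, (ENNReal.ofReal_toReal hδ.ne).symm⟩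
  obtain ⟨D, hD0, hDe⟩ : ∃ D : ℝ, 0 ≤ D ∧ Metric.ediam (inEpsSpace S ε Y) = ENNReal.ofReal D :=
    ⟨_, ENNReal.toReal_nonneg, (ENNReal.ofReal_toReal hD).symm⟩
  have hr' : δ * (D + ε / 2) < r := by
    have e2 : ENNReal.ofReal ε / 2 = ENNReal.ofReal (ε / 2) := by
      rw [ENNReal.ofReal_div_of_pos (by norm_num)]; simp
    rw [hδe, hDe, e2, ← ENNReal.ofReal_add hD0 (by positivity), ← ENNReal.ofReal_mul hδ0,
      ← ENNReal.ofReal_coe_nnreal] at hr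
    exact (ENNReal.ofReal_lt_ofReal_iff_of_nonneg (by positivity)).1 hr
  -- `η` uses the slack of the strict inequality: `ε`-paths of length up to `D + η` still have
  -- images of diameter at most `r`. The divisor `δ + 1` is positive even if `δ = 0`.
  obtain ⟨η, hη0, hηε, hηr⟩ : ∃ η, 0 < η ∧ η ≤ ε ∧ δ * (D + η + ε / 2) ≤ r := by
    refine ⟨min ε ((r - δ * (D + ε / 2)) / (δ + 1)), ?_, min_le_left _ _, ?_⟩
    · exact lt_min hε (div_pos (sub_pos.2 hr') (by positivity))
    · have h1 : min ε ((r - δ * (D + ε / 2)) / (δ + 1)) ≤ (r - δ * (D + ε / 2)) / (δ + 1) :=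
        min_le_right _ _
      have h0 : 0 < min ε ((r - δ * (D + ε / 2)) / (δ + 1)) :=
        lt_min hε (div_pos (sub_pos.2 hr') (by positivity))
      rw [le_div_iff₀ (by positivity)] at h1
      linarith
  have hfin : ∀ x y : LengthSpace G, edist x y ≠ ⊤ := fun x y =>
    ((lengthDist_le_distortion_mul (G := G) x y).trans_lt
      (ENNReal.mul_lt_top hδ (edist_lt_top (α := G) _ _))).ne
  obtain ⟨M, hM, hU, hA⟩ := IsMetricGraph.exists_metricSpace hG hfin hru
  have hM' : ∀ x y : LengthSpace G,
      lengthDist (G := G) x y = ENNReal.ofReal (dist x y) := hM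
  have hle : ∀ x y : LengthSpace G, dist x.1 y.1 ≤ dist x y := by
    intro x y
    have : edist x.1 y.1 ≤ lengthDist (G := G) x y := edist_le_lengthDist (G := G) x y
    rw [hM', edist_dist] at this
    exact (ENNReal.ofReal_le_ofReal_iff dist_nonneg).1 this
  have hge : ∀ x y : LengthSpace G, dist x y ≤ δ * dist x.1 y.1 := by
    intro x y
    have : lengthDist (G := G) x y ≤ distortion G * edist x.1 y.1 :=
      lengthDist_le_distortion_mul (G := G) x y
    rw [hM', edist_dist, hδe, ← ENNReal.ofReal_mul hδ0] at this
    exact (ENNReal.ofReal_le_ofReal_iff (mul_nonneg hδ0 dist_nonneg)).1 this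
  have hgδ : ∀ p q : EpsSpace S ε, dist (g p) (g q) ≤ δ * (dist p.1 q.1 + ε / 2) := by
    intro p q
    refine (hge _ _).trans (mul_le_mul_of_nonneg_left ?_ hδ0)
    have h1 := hg p
    have h2 := hg q
    rw [dist_comm] at h1
    linarith [dist_triangle4 (g p).1 p.1 q.1 (g q).1]
  -- Here `2 * κ = δ * (ε + ε / 2)` bounds the image of one step of an `ε`-path. Sampling a geodesic
  -- of that length costs at most twice the length plus `ε`.
  have hE : ∀ p q : EpsSpace S ε, dist (g p) (g q) ≤ 2 * r →
      dist (g p) (g q) ≤ 2 * (3 * δ * ε / 4) →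
      edist p q ≤ ENNReal.ofReal (3 * δ * ε + ε) := by
    intro p q hpq hpq'
    obtain ⟨c, hc⟩ := hU.exists_arc _ _ hpq
    refine (epsDist_le_of_lipschitz (S := S) hε (c := fun t => (c t).1) dist_nonneg
      (fun s hs t ht => (hle _ _).trans (hc.2.2 s hs t ht).le)
      (fun s _ => hGS _ (c s).2) (p := p) (q := q) ?_ ?_).trans (ENNReal.ofReal_le_ofReal ?_)
    · rw [hc.1, dist_comm]
      exact hg p
    · rw [hc.2.1, dist_comm]
      exact hg q
    · linarith
  have hchain : ∀ p ∈ inEpsSpace S ε Y, ∀ q ∈ inEpsSpace S ε Y,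
      ∃ n z Λ, IsChainAlong g r (3 * δ * ε / 4) ε (D + η) p q n z Λ := by
    intro p hp q hq
    have hlt : epsDist (S := S) ε p q < ENNReal.ofReal (D + η) := by
      have : epsDist (S := S) ε p q ≤ ENNReal.ofReal D := by
        rw [← hDe]
        exact Metric.edist_le_ediam_of_mem hp hq
      exact this.trans_lt ((ENNReal.ofReal_lt_ofReal_iff (by linarith)).2 (by linarith))
    obtain ⟨n, y, hy, hlen⟩ := exists_isEpsPath_of_epsDist_lt hlt
    set Λ : ℕ → ℝ := fun j => ∑ k ∈ Finset.range j, dist (y k) (y (k + 1)) with hΛ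
    have hmono : Monotone Λ := monotone_nat_of_le_succ fun i => by
      simp only [hΛ, Finset.sum_range_succ]
      exact le_add_of_nonneg_right dist_nonneg
    have h0 : Λ 0 = 0 := Finset.sum_range_zero _
    have hed : ∀ i j, i ≤ j → j ≤ n → epsDist ε (y i) (y j) ≤ ENNReal.ofReal (Λ j - Λ i) :=
      fun i j hij hj => epsDist_le_sum hij fun k _ hk => hy.2.2 k (hk.trans_le hj)
    have hnear : ∀ i j, i ≤ j → j ≤ n → dist (g (y i)) (g (y j)) ≤ r := by
      intro i j hij hj
      have h1 := (edist_le_epsDist ε (y i) (y j)).trans (hed i j hij hj)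
      rw [edist_dist] at h1
      have h2 := (ENNReal.ofReal_le_ofReal_iff (sub_nonneg.2 (hmono hij))).1 h1
      have h3 := hmono (Nat.zero_le i)
      have h4 := hmono hj
      refine (hgδ (y i) (y j)).trans (le_trans (mul_le_mul_of_nonneg_left ?_ hδ0) hηr)
      have h5 : dist (y i).1 (y j).1 ≤ D + η := h2.trans (by linarith)
      linarith
    refine ⟨n, y, Λ, hy.1, hy.2.1, h0, hmono, hed, fun i hi => ?_, hlen, fun i hi j hj => ?_,
      fun i hi => ?_⟩
    · simp only [hΛ, Finset.sum_range_succ]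
      linarith [hy.2.2 i hi]
    · rcases le_total i j with h | h
      · exact hnear i j h hj
      · rw [dist_comm]
        exact hnear j i h hi
    · have h1 : dist (y i).1 (y (i + 1)).1 < ε := hy.2.2 i hi
      have h2 := hgδ (y i) (y (i + 1))
      have h3 : δ * (dist (y i).1 (y (i + 1)).1 + ε / 2) ≤ δ * (ε + ε / 2) := by gcongr
      linarith
  obtain ⟨a, ha, b, hb, hab⟩ := exists_ediam_le_edist_add hne hD (η := ENNReal.ofReal η)
    (by simpa using hη0)
  rw [hDe] at hab
  obtain ⟨x, hx⟩ := exists_circumcenter_of_chains hU hA g (by positivity) hε.le hη0.le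
    (by positivity) hE ha hb hab hchain
  refine ⟨x, fun y hy => ?_⟩
  rw [Metric.mem_closedEBall, edist_comm]
  refine (hx y hy).trans ?_
  have e : Metric.ediam (inEpsSpace S ε Y) / 2 + (9 * distortion G + 8) * ENNReal.ofReal ε =
      ENNReal.ofReal (D / 2 + (9 * δ + 8) * ε) := by
    rw [ENNReal.ofReal_add (by positivity) (by positivity), ENNReal.ofReal_mul (by positivity),
      ENNReal.ofReal_add (by positivity) (by positivity), ENNReal.ofReal_mul (by positivity),
      ENNReal.ofReal_div_of_pos (by norm_num), hDe, hδe]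
    simp
  rw [e]
  -- With `η ≤ ε` the total error is at most `(6 * δ + 11 / 2) * ε`.
  refine ENNReal.ofReal_le_ofReal ?_
  have : 0 ≤ δ * ε := by positivity
  linarith
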